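/- Fix constants $0<z<q<p\le 1$. For $N\ge 1$ let $G$ be a random undirected graph on $2N$ nodes, $N$ of label $0$ and $N$ of label $1$, in which every unordered pair of nodes (self-pairs included) is an edge independently of the others, with probability $p$ if both nodes have label $0$, $q$ if both have label $1$, and $z$ if the labels differ. Let $A$ be the adjacency matrix of $G$, $D$ the diagonal matrix of its row sums, and $L=I-D^{-1/2}AD^{-1/2}$ the Laplacian of $G$ (with $D^{-1/2}_{uu}=0$ if $D_{uu}=0$). Choose, for every graph, an orthonormal basis of eigenvectors of $L$ listed in ascending order of the eigenvalues, and for a node $v$ let $\lambda(v)=(\lambda_2(v),\lambda_3(v))\in\mathbb R^2$ be the values at $v$ of the second and the third basis vector. For $\epsilon>0$ let $$C_\epsilon(v)=\Big\{u:\ \|\lambda(u)-\lambda(v)\|\le \tfrac{\epsilon}{\sqrt N}\Big\}$$ with the Euclidean norm; this is the crop with threshold $\epsilon$ for eigenvectors rescaled to have norm $\sqrt N$. Then there is an $\epsilon>0$, depending only on $p,q,z$, such that for every such choice of eigenvectors (a function of the graph) the following hold. 1. If $v$ is a uniformly random node, independent of $G$, then with probability tending to $1$ as $N\to\infty$ the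 majority label in $C_\epsilon(v)$ is the label of $v$ (strictly more nodes of $C_\epsilon(v)$ have the label of $v$ than the other label). 2. If $v,v'$ are independent uniformly random nodes, independent of $G$, then, conditionally on $v,v'$ having different labels, the probability that the subgraphs of $G$ induced on $C_\epsilon(v)$ and $C_\epsilon(v')$ are not isomorphic tends to $1$ as $N\to\infty$. 3. If $v$ is a uniformly random node, independent of $G$, then with probability tending to $1$ as $N\to\infty$ there is no node $v'$ whose label differs from that of $v$ and for which the subgraph induced on $C_\epsilon(v')$ is isomorphic to the subgraph induced on $C_\epsilon(v)$. -/

import Mathlib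

open MeasureTheory ProbabilityTheory Filter Topology

noncomputable section

/-- The `2N` nodes of the two-block model: `(i, k)` is the `k`-th node of label `i`. -/
abbrev Node (N : ℕ) : Type := Fin 2 × Fin N

/-- The label (block) `Y(v)` of a node. -/
def label {N : ℕ} (v : Node N) : Fin 2 := v.1

/-- An undirected graph on the nodes, self-edges allowed: an indicator of the unordered pairs
(loops included) that are edges. -/
abbrev LoopGraph (N : ℕ) : Type := Sym2 (Node N) → Bool

/-- Adjacency in a graph with possible self-edges. -/
def Adjacent {N : ℕ} (G : LoopGraph N) (u v : Node N) : Prop := G s(u, v) = true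

/-- Edge probabilities: `p` inside block `0`, `q` inside block `1`, `z` across. -/
def edgeProb (N : ℕ) (p q z : unitInterval) : Sym2 (Node N) → unitInterval :=
  Sym2.lift ⟨fun u v => if label u = label v then (if label u = 0 then p else q) else z, by
    intro u v
    by_cases h : label u = label v
    · simp [h]
    · simp [h, Ne.symm h]⟩

/-- The law of the two-block stochastic block model: every unordered pair of nodes, self-pairs
included, is an edge independently of the others, with probability `edgeProb`. -/
def sbm (N : ℕ) (p q z : unitInterval) : Measure (LoopGraph N) :=
  Measure.pi fun e => bernoulliMeasure true false (edgeProb N p q z e)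

/-- The uniform distribution on the nodes. -/
def uniformNode (N : ℕ) : Measure (Node N) := uniformOn Set.univ

/-- The `0/1` adjacency matrix. -/
def adjacencyMatrix {N : ℕ} (G : LoopGraph N) : Matrix (Node N) (Node N) ℝ :=
  Matrix.of fun u v => if G s(u, v) then 1 else 0

/-- The degree of a node: its row sum in the adjacency matrix. -/
def nodeDegree {N : ℕ} (G : LoopGraph N) (u : Node N) : ℝ := ∑ v, adjacencyMatrix G u v

/-- The Laplacian `I - D^{-1/2} A D^{-1/2}` (with `D^{-1/2}` equal to `0` at isolated nodes). -/
def laplacian {N : ℕ} (G : LoopGraph N) : Matrix (Node N) (Node N) ℝ :=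
  1 - Matrix.diagonal (fun u => (√(nodeDegree G u))⁻¹) * adjacencyMatrix G *
    Matrix.diagonal (fun u => (√(nodeDegree G u))⁻¹)

/-- Enumerated orthonormal bases of `ℝ^(2N)`. -/
abbrev NodeBasis (N : ℕ) : Type :=
  OrthonormalBasis (Fin (Fintype.card (Node N))) ℝ (EuclideanSpace ℝ (Node N))

/-- `b` consists of (unit, mutually orthogonal) eigenvectors of `M`, listed in ascending order of
their eigenvalues. -/
def IsSortedEigenbasis {N : ℕ} (M : Matrix (Node N) (Node N) ℝ) (b : NodeBasis N) : Prop :=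
  ∃ μ : Fin (Fintype.card (Node N)) → ℝ, Monotone μ ∧
    ∀ i u, M.mulVec (fun w => b i w) u = μ i * b i u

/-- The value at the node `v` of the vector with (zero-based) position `j` in the basis
(and `0` if the basis has at most `j` elements). -/
def basisValue {N : ℕ} (b : NodeBasis N) (j : ℕ) (v : Node N) : ℝ :=
  if h : j < Fintype.card (Node N) then b ⟨j, h⟩ v else 0

/-- The spectral embedding `λ(v) = (λ₂(v), λ₃(v))`: the values at `v` of the second and of the
third eigenvector. -/
def spectralEmbedding {N : ℕ} (b : NodeBasis N) (v : Node N) : EuclideanSpace ℝ (Fin 2) :=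
  !₂[basisValue b 1 v, basisValue b 2 v]

/-- The cropped neighbourhood `C_ε(v)`. -/
def crop {N : ℕ} (b : NodeBasis N) (ε : ℝ) (v : Node N) : Set (Node N) :=
  {u | ‖spectralEmbedding b u - spectralEmbedding b v‖ ≤ ε}

/-- `i` is the majority label in `C`: strictly more nodes of `C` have label `i` than do not. -/
def IsMajorityLabel {N : ℕ} (C : Set (Node N)) (i : Fin 2) : Prop :=
  {u ∈ C | label u ≠ i}.ncard < {u ∈ C | label u = i}.ncard

/-- The subgraphs of `G` induced on `C` and on `C'` are isomorphic. -/
def InducedIso {N : ℕ} (G : LoopGraph N) (C C' : Set (Node N)) : Prop :=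
  Nonempty ((fun a b : C => Adjacent G a b) ≃r (fun a b : C' => Adjacent G a b))

end

noncomputable section

/-! Split the adjacency matrix as `A = B + W`, with `B` constant on blocks and `W` the centred
noise. For each fixed `δ > 0`, with probability tending to 1, `W` has operator norm at most `δN` and
all its block row sums are at most `δN` (`IsTypical`). The rest is deterministic on such events.

Labels. Because `q > z`, the second eigenvalue of the Laplacian is at most `1 - (q - z)/6`
(`IsTypical.second_eigenvalue_le`), so the second eigenvector is carried by `B` rather than by `W`.
Divided by the square roots of the degrees and rescaled, it is uniformly `O(δ)`-close to a function
of the label, whose two values approximately solve a 2×2 eigenproblem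
(`IsTypical.exists_block_close`). With the degree weights restored, these values cannot nearly
agree, since the symmetric 2×2 matrix has distinct diagonal entries `p/(p+z)` and `q/(q+z)`
(`eigenvector_gap`). The second coordinate thus separates the blocks at scale `N^(-1/2)`, and a crop
of smaller radius contains a single label. Nothing is needed about the third eigenvector here: an
extra coordinate only shrinks crops.

Isomorphism. The embedding coordinates have bounded second moment, so by pigeonhole all but a small
fraction of the nodes have crops of size at least `cN` (`exists_card_small_crop_le`). A one-label
set `C` has edge density `p` or `q` up to `δN/|C|`, uniformly over all `C`, so the dependence of
crops on the graph is harmless. Crops of linear size and different labels therefore have different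
edge counts and are not isomorphic (`IsTypical.ncard_le_of_inducedIso`). This gives the third claim;
the second follows since the conditioning event has probability at least 1/4. -/

instance isProbabilityMeasure_sbm (N : ℕ) (p q z : unitInterval) :
    IsProbabilityMeasure (sbm N p q z) := by
  unfold sbm; infer_instance

/-- The centred edge indicator of the unordered pair `e`. -/
def edgeNoise {N : ℕ} (p q z : unitInterval) (G : LoopGraph N) (e : Sym2 (Node N)) : ℝ :=
  (if G e then 1 else 0) - (edgeProb N p q z e : ℝ)

/-! ### Concentration of the centred adjacency matrix. -/

section Noise

variable {N : ℕ} (p q z : unitInterval)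

lemma measurable_edgeNoise (e : Sym2 (Node N)) :
    Measurable fun G : LoopGraph N => edgeNoise p q z G e :=
  measurable_of_countable _

lemma abs_edgeNoise_le (G : LoopGraph N) (e : Sym2 (Node N)) : |edgeNoise p q z G e| ≤ 1 := by
  have h0 := (edgeProb N p q z e).2.1
  have h1 := (edgeProb N p q z e).2.2
  unfold edgeNoise
  rw [abs_le]
  split_ifs <;> constructor <;> linarith

lemma integrable_of_loopGraph (f : LoopGraph N → ℝ) : Integrable f (sbm N p q z) :=
  Integrable.of_finite

lemma iIndepFun_edgeNoise :
    iIndepFun (fun e (G : LoopGraph N) => edgeNoise p q z G e) (sbm N p q z) :=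
  iIndepFun_pi (X := fun e (x : Bool) => (if x then (1 : ℝ) else 0) - (edgeProb N p q z e : ℝ))
    fun _ => (measurable_of_countable _).aemeasurable

lemma integral_edgeNoise (e : Sym2 (Node N)) :
    ∫ G, edgeNoise p q z G e ∂(sbm N p q z) = 0 := by
  have h := integral_comp_eval (μ := fun e => bernoulliMeasure true false (edgeProb N p q z e))
    (i := e) (f := fun x : Bool => (if x then (1 : ℝ) else 0) - (edgeProb N p q z e : ℝ))
    (measurable_of_countable _).aestronglyMeasurable
  have h2 : ∫ G, edgeNoise p q z G e ∂(sbm N p q z) = _ := h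
  rw [h2, integral_bernoulliMeasure]
  simp
  ring

lemma integral_edgeNoise_mul (e : Sym2 (Node N)) (T : Finset (Sym2 (Node N))) (he : e ∉ T)
    (φ : (T → ℝ) → ℝ) (hφ : Measurable φ) :
    ∫ G, edgeNoise p q z G e * φ (fun i => edgeNoise p q z G i) ∂(sbm N p q z) = 0 := by
  have h := (iIndepFun_edgeNoise p q z (N := N)).indepFun_finset {e} T (by simpa using he)
    (fun e => measurable_edgeNoise p q z e)
  have hm : Measurable fun x : ({e} : Finset (Sym2 (Node N))) → ℝ => x ⟨e, by simp⟩ :=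
    measurable_pi_apply (⟨e, by simp⟩ : ({e} : Finset (Sym2 (Node N))))
  have h2 := h.comp (φ := fun x : ({e} : Finset (Sym2 (Node N))) → ℝ => x ⟨e, by simp⟩)
    hm hφ
  have h3 := h2.integral_fun_mul_eq_mul_integral
    (measurable_of_countable _).aestronglyMeasurable
    (measurable_of_countable _).aestronglyMeasurable
  simp only [Function.comp_def] at h3
  rw [h3, integral_edgeNoise, zero_mul]

/-- One factor that is independent of the rest and centred kills the product; the other three edges
may coincide with each other. -/
lemma integral_edgeNoise_mul₄ (e e₂ e₃ e₄ : Sym2 (Node N)) (h₂ : e ≠ e₂) (h₃ : e ≠ e₃)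
    (h₄ : e ≠ e₄) :
    ∫ G, edgeNoise p q z G e * edgeNoise p q z G e₂ *
      (edgeNoise p q z G e₃ * edgeNoise p q z G e₄) ∂(sbm N p q z) = 0 := by
  have h := integral_edgeNoise_mul p q z e {e₂, e₃, e₄} (by simp [h₂, h₃, h₄])
    (fun x => x ⟨e₂, by simp⟩ * (x ⟨e₃, by simp⟩ * x ⟨e₄, by simp⟩)) (by fun_prop)
  simpa only [mul_assoc] using h

/-- The sum of the squared entries of the square of the centred adjacency matrix. -/
def noiseQuartic (G : LoopGraph N) : ℝ :=
  ∑ u, ∑ v, (∑ w, edgeNoise p q z G s(u, w) * edgeNoise p q z G s(w, v)) ^ 2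

lemma noiseQuartic_nonneg (G : LoopGraph N) : 0 ≤ noiseQuartic p q z G := by
  unfold noiseQuartic; positivity

/-- On the closed walk `u, w, v, w', u` the edge `uw` must be repeated for the expectation to
survive. The three indicators list the ways it can equal `wv`, `uw'` or `w'v`. -/
lemma integral_edgeNoise_cycle_le (u v w w' : Node N) :
    ∫ G, edgeNoise p q z G s(u, w) * edgeNoise p q z G s(w, v) *
      (edgeNoise p q z G s(u, w') * edgeNoise p q z G s(w', v)) ∂(sbm N p q z) ≤
    (if u = v then 1 else 0) + (if w = w' then 1 else 0) + (if u = w' ∧ w = v then 1 else 0) := by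
  by_cases h : u = v ∨ w = w' ∨ (u = w' ∧ w = v)
  · have h1 : ∫ G, edgeNoise p q z G s(u, w) * edgeNoise p q z G s(w, v) *
      (edgeNoise p q z G s(u, w') * edgeNoise p q z G s(w', v)) ∂(sbm N p q z) ≤
        ∫ _, (1 : ℝ) ∂(sbm N p q z) := by
      refine integral_mono (integrable_of_loopGraph _ _ _ _) (integrable_of_loopGraph _ _ _ _) ?_
      intro G
      refine (le_abs_self _).trans ?_
      simp only [abs_mul]
      have := abs_edgeNoise_le p q z G
      exact mul_le_one₀ (mul_le_one₀ (this _) (abs_nonneg _) (this _)) (by positivity)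
        (mul_le_one₀ (this _) (abs_nonneg _) (this _))
    refine h1.trans ?_
    simp only [integral_const, probReal_univ, smul_eq_mul, mul_one]
    rcases h with h | h | h
    · rw [if_pos h]; split_ifs <;> norm_num
    · rw [if_pos h]; split_ifs <;> norm_num
    · rw [if_pos h]; split_ifs <;> norm_num
  · push Not at h
    obtain ⟨h1, h2, h3⟩ := h
    rw [integral_edgeNoise_mul₄]
    · positivity
    · intro h; rw [Sym2.eq_iff] at h; grind
    · intro h; rw [Sym2.eq_iff] at h; grind
    · intro h; rw [Sym2.eq_iff] at h; grind

lemma integral_noiseQuartic_le :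
    ∫ G, noiseQuartic p q z G ∂(sbm N p q z) ≤ 3 * (2 * N : ℝ) ^ 3 := by
  unfold noiseQuartic
  have hexp : ∀ G : LoopGraph N,
      ∑ u, ∑ v, (∑ w, edgeNoise p q z G s(u, w) * edgeNoise p q z G s(w, v)) ^ 2 =
      ∑ u, ∑ v, ∑ w, ∑ w', edgeNoise p q z G s(u, w) * edgeNoise p q z G s(w, v) *
        (edgeNoise p q z G s(u, w') * edgeNoise p q z G s(w', v)) := by
    intro G
    simp only [sq, Finset.sum_mul_sum]
  simp only [hexp]
  have hint : ∫ G, (∑ u : Node N, ∑ v : Node N, ∑ w : Node N, ∑ w' : Node N,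
      edgeNoise p q z G s(u, w) * edgeNoise p q z G s(w, v) *
        (edgeNoise p q z G s(u, w') * edgeNoise p q z G s(w', v))) ∂(sbm N p q z) =
      ∑ u : Node N, ∑ v : Node N, ∑ w : Node N, ∑ w' : Node N,
      ∫ G, edgeNoise p q z G s(u, w) * edgeNoise p q z G s(w, v) *
        (edgeNoise p q z G s(u, w') * edgeNoise p q z G s(w', v)) ∂(sbm N p q z) := by
    rw [integral_finsetSum _ fun _ _ => integrable_of_loopGraph _ _ _ _]
    refine Finset.sum_congr rfl fun _ _ => ?_
    rw [integral_finsetSum _ fun _ _ => integrable_of_loopGraph _ _ _ _]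
    refine Finset.sum_congr rfl fun _ _ => ?_
    rw [integral_finsetSum _ fun _ _ => integrable_of_loopGraph _ _ _ _]
    refine Finset.sum_congr rfl fun _ _ => ?_
    rw [integral_finsetSum _ fun _ _ => integrable_of_loopGraph _ _ _ _]
  rw [hint]
  have hle : ∑ u : Node N, ∑ v : Node N, ∑ w : Node N, ∑ w' : Node N,
      ∫ G, edgeNoise p q z G s(u, w) * edgeNoise p q z G s(w, v) *
        (edgeNoise p q z G s(u, w') * edgeNoise p q z G s(w', v)) ∂(sbm N p q z) ≤
      ∑ u : Node N, ∑ v : Node N, ∑ w : Node N, ∑ w' : Node N,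
        ((if u = v then 1 else 0) + (if w = w' then 1 else 0) +
          (if u = w' ∧ w = v then 1 else 0) : ℝ) := by
    refine Finset.sum_le_sum fun u _ => ?_
    refine Finset.sum_le_sum fun v _ => ?_
    refine Finset.sum_le_sum fun w _ => ?_
    exact Finset.sum_le_sum fun w' _ => integral_edgeNoise_cycle_le p q z u v w w'
  refine hle.trans ?_
  have hc : ∀ u w : Node N, ∑ v : Node N, ∑ w' : Node N,
      (if u = w' ∧ w = v then (1 : ℝ) else 0) = 1 := by
    intro u w
    simp [ite_and, Finset.sum_ite_eq]
  have hc2 : ∀ u : Node N, ∑ v : Node N, ∑ w : Node N, ∑ w' : Node N,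
      (if u = w' ∧ w = v then (1 : ℝ) else 0) = 2 * N := by
    intro u
    rw [Finset.sum_comm, Finset.sum_congr rfl fun w _ => hc u w]
    simp
  have h3 : ∑ u : Node N, ∑ v : Node N, ∑ w : Node N, ∑ w' : Node N,
      (if u = w' ∧ w = v then (1 : ℝ) else 0)
      = (2 * N) ^ 2 := by
    simp only [hc2]; simp; ring
  -- The first two indicators contribute `(2N)^3` each and the last only `(2N)^2`.
  simp only [Finset.sum_add_distrib, h3]
  simp
  rcases Nat.eq_zero_or_pos N with h | h
  · simp [h]
  · have : (1 : ℝ) ≤ N := by exact_mod_cast h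
    nlinarith [sq_nonneg (N : ℝ), mul_nonneg (sq_nonneg (N : ℝ)) (sub_nonneg.2 this)]

/-- With `W` symmetric, `‖Wy‖² = ⟨y, W²y⟩`. Cauchy–Schwarz bounds this by `‖y‖ ‖W²y‖`, and the
Frobenius norm of `W²` controls the last factor. -/
lemma sum_sq_mulVec_sq_le (G : LoopGraph N) (y : Node N → ℝ) :
    (∑ v, (∑ u, edgeNoise p q z G s(v, u) * y u) ^ 2) ^ 2 ≤
      noiseQuartic p q z G * (∑ u, y u ^ 2) ^ 2 := by
  have h1 : ∑ v, (∑ u, edgeNoise p q z G s(v, u) * y u) ^ 2 =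
      ∑ u, y u * ∑ u', (∑ v, edgeNoise p q z G s(u, v) * edgeNoise p q z G s(v, u')) * y u' := by
    simp only [sq, Finset.mul_sum, Finset.sum_mul]
    rw [Finset.sum_comm]
    refine Finset.sum_congr rfl fun u _ => ?_
    rw [Finset.sum_comm]
    refine Finset.sum_congr rfl fun u' _ => Finset.sum_congr rfl fun v _ => ?_
    rw [Sym2.eq_swap (a := v) (b := u)]
    ring
  rw [h1]
  refine (Finset.sum_mul_sq_le_sq_mul_sq _ _ _).trans ?_
  have h2 : ∑ u, (∑ u', (∑ v, edgeNoise p q z G s(u, v) * edgeNoise p q z G s(v, u')) * y u') ^ 2 ≤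
      noiseQuartic p q z G * ∑ u, y u ^ 2 := by
    unfold noiseQuartic
    rw [Finset.sum_mul]
    exact Finset.sum_le_sum fun u _ => Finset.sum_mul_sq_le_sq_mul_sq _ _ _
  calc _ ≤ (∑ u, y u ^ 2) * (noiseQuartic p q z G * ∑ u, y u ^ 2) :=
        mul_le_mul_of_nonneg_left h2 (by positivity)
    _ = _ := by ring

/-- The centred adjacency matrix has operator norm at most `δ N`, and all its block row sums are
at most `δ N`. -/
structure IsTypical (δ : ℝ) (G : LoopGraph N) : Prop where
  sum_sq_le : ∀ y : Node N → ℝ, ∑ v, (∑ u, edgeNoise p q z G s(v, u) * y u) ^ 2 ≤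
    (δ * N) ^ 2 * ∑ u, y u ^ 2
  abs_rowSum_le : ∀ (v : Node N) (i : Fin 2),
    |∑ k : Fin N, edgeNoise p q z G s(v, (i, k))| ≤ δ * N

lemma isTypical_of_quartic {δ : ℝ} {G : LoopGraph N}
    (h : noiseQuartic p q z G ≤ δ ^ 4 * N ^ 4)
    (h' : ∀ (v : Node N) (i : Fin 2), |∑ k : Fin N, edgeNoise p q z G s(v, (i, k))| ≤ δ * N) :
    IsTypical p q z δ G := by
  refine ⟨fun y => ?_, h'⟩
  refine abs_le_of_sq_le_sq' ?_ (by positivity) |>.2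
  refine (sum_sq_mulVec_sq_le p q z G y).trans ?_
  calc _ ≤ (δ ^ 4 * N ^ 4) * (∑ u, y u ^ 2) ^ 2 := mul_le_mul_of_nonneg_right h (by positivity)
    _ = _ := by ring

lemma measureReal_quartic_le {δ : ℝ} (hδ : 0 < δ) (hN : 0 < N) :
    (sbm N p q z).real {G | δ ^ 4 * N ^ 4 ≤ noiseQuartic p q z G} ≤ 24 / δ ^ 4 * (N : ℝ)⁻¹ := by
  have hN' : (0 : ℝ) < N := by exact_mod_cast hN
  have h := mul_meas_ge_le_integral_of_nonneg (μ := sbm N p q z)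
    (f := noiseQuartic p q z) (Eventually.of_forall (noiseQuartic_nonneg p q z))
    (integrable_of_loopGraph p q z _) (δ ^ 4 * N ^ 4)
  have h2 := h.trans (integral_noiseQuartic_le p q z)
  rw [mul_comm, ← le_div_iff₀ (by positivity)] at h2
  refine h2.trans (le_of_eq ?_)
  field_simp
  norm_num

/-- Hoeffding's inequality; the sign `s` covers both tails. An exponential rate leaves room for the
union bound over all nodes. -/
lemma measureReal_sum_ge_le {δ : ℝ} (hδ : 0 < δ) (hN : 0 < N) (s : ℝ) (hs : |s| = 1)
    (v : Node N) (i : Fin 2) :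
    (sbm N p q z).real {G | δ * N ≤ ∑ k : Fin N, s * edgeNoise p q z G s(v, (i, k))} ≤
      Real.exp (-(δ ^ 2 / 2) * N) := by
  have hinj : Function.Injective fun k : Fin N => s(v, ((i, k) : Node N)) := by
    intro k k' h
    simp only [Sym2.eq_iff] at h
    grind
  have hind : iIndepFun (fun (k : Fin N) (G : LoopGraph N) =>
      s * edgeNoise p q z G s(v, (i, k))) (sbm N p q z) :=
    ((iIndepFun_edgeNoise p q z).precomp hinj).comp (fun _ x => s * x) fun _ => by fun_prop
  have hsub : ∀ k ∈ (Finset.univ : Finset (Fin N)), HasSubgaussianMGF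
      (fun G : LoopGraph N => s * edgeNoise p q z G s(v, (i, k))) ((‖(1 : ℝ) - (-1)‖₊ / 2) ^ 2)
      (sbm N p q z) := by
    intro k _
    refine hasSubgaussianMGF_of_mem_Icc_of_integral_eq_zero
      (measurable_of_countable _).aemeasurable (Eventually.of_forall fun G => ?_) ?_
    · rw [Set.mem_Icc, ← abs_le, abs_mul, hs, one_mul]
      exact abs_edgeNoise_le p q z G _
    · rw [integral_const_mul, integral_edgeNoise, mul_zero]
  have h := HasSubgaussianMGF.measure_sum_ge_le_of_iIndepFun hind hsub
    (ε := δ * N) (by positivity)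
  refine h.trans (le_of_eq ?_)
  have hN' : (0 : ℝ) < N := by exact_mod_cast hN
  have h2 : ‖(1 : ℝ) - (-1)‖₊ = 2 := by ext; norm_num
  congr 1
  simp only [h2, Finset.sum_const, Finset.card_univ, Fintype.card_fin]
  simp
  field_simp

/-- Markov's inequality for the quartic, plus a union bound over `4N` pairs (node, block) and two
signs. -/
lemma measureReal_not_isTypical_le {δ : ℝ} (hδ : 0 < δ) (hN : 0 < N) :
    (sbm N p q z).real {G | ¬ IsTypical p q z δ G} ≤
      24 / δ ^ 4 * (N : ℝ)⁻¹ + 8 * (N * Real.exp (-(δ ^ 2 / 2) * N)) := by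
  have hsub : {G : LoopGraph N | ¬ IsTypical p q z δ G} ⊆
      {G | δ ^ 4 * N ^ 4 ≤ noiseQuartic p q z G} ∪
      ⋃ x : Node N × Fin 2,
        ({G | δ * N ≤ ∑ k : Fin N, 1 * edgeNoise p q z G s(x.1, (x.2, k))} ∪
        {G | δ * N ≤ ∑ k : Fin N, (-1) * edgeNoise p q z G s(x.1, (x.2, k))}) := by
    intro G hG
    by_contra hc
    simp only [Set.mem_union, Set.mem_ofPred_eq, Set.mem_iUnion, not_or, not_exists, not_le,
      ← Finset.mul_sum] at hc
    refine hG (isTypical_of_quartic p q z hc.1.le fun v i => abs_le.2 ?_)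
    have := hc.2 (v, i)
    constructor <;> linarith [this.1, this.2]
  refine (measureReal_mono hsub).trans ((measureReal_union_le _ _).trans ?_)
  refine add_le_add (measureReal_quartic_le p q z hδ hN)
    ((measureReal_iUnion_fintype_le _).trans ?_)
  refine (Finset.sum_le_sum fun x _ => (measureReal_union_le _ _).trans (add_le_add
    (measureReal_sum_ge_le p q z hδ hN 1 (by simp) x.1 x.2)
    (measureReal_sum_ge_le p q z hδ hN (-1) (by simp) x.1 x.2))).trans (le_of_eq ?_)
  simp
  ring

lemma tendsto_measure_not_isTypical {δ : ℝ} (hδ : 0 < δ) :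
    Tendsto (fun N : ℕ => (sbm N p q z) {G | ¬ IsTypical p q z δ G}) atTop (𝓝 0) := by
  have h0 : Tendsto (fun N : ℕ => (N : ℝ) * Real.exp (-(δ ^ 2 / 2) * N)) atTop (𝓝 0) := by
    have := tendsto_rpow_mul_exp_neg_mul_atTop_nhds_zero 1 (δ ^ 2 / 2) (by positivity)
    simpa [Function.comp_def] using this.comp (tendsto_natCast_atTop_atTop (R := ℝ))
  have h1 : Tendsto (fun N : ℕ => 24 / δ ^ 4 * (N : ℝ)⁻¹ +
      8 * (N * Real.exp (-(δ ^ 2 / 2) * N))) atTop (𝓝 0) := by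
    simpa using (tendsto_inv_atTop_nhds_zero_nat (𝕜 := ℝ)).const_mul (24 / δ ^ 4) |>.add
      (h0.const_mul 8)
  have h2 : Tendsto (fun N : ℕ => (sbm N p q z).real {G | ¬ IsTypical p q z δ G}) atTop (𝓝 0) :=
    squeeze_zero' (Eventually.of_forall fun _ => measureReal_nonneg)
      ((eventually_gt_atTop 0).mono fun _ hN => measureReal_not_isTypical_le p q z hδ hN) h1
  rwa [← ENNReal.tendsto_toReal_iff (fun _ => measure_ne_top _ _) ENNReal.zero_ne_top,
    ENNReal.toReal_zero]

end Noise

/-- The edge probability between the blocks `i` and `j`. -/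
def blockProb (p q z : unitInterval) (i j : Fin 2) : ℝ :=
  if i = j then (if i = 0 then (p : ℝ) else q) else z

/-- The expected degree in block `i`, divided by the block size. -/
def blockDegree (p q z : unitInterval) (i : Fin 2) : ℝ := ∑ j, blockProb p q z i j

/-! ### The expected block matrix. -/

section Block

variable (p q z : unitInterval)

lemma blockProb_zero_zero : blockProb p q z 0 0 = p := by simp [blockProb]
lemma blockProb_one_one : blockProb p q z 1 1 = q := by simp [blockProb]
lemma blockProb_zero_one : blockProb p q z 0 1 = z := by simp [blockProb]
lemma blockProb_one_zero : blockProb p q z 1 0 = z := by simp [blockProb]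

lemma blockDegree_zero : blockDegree p q z 0 = p + z := by
  simp [blockDegree, Fin.sum_univ_two, blockProb]

lemma blockDegree_one : blockDegree p q z 1 = q + z := by
  simp [blockDegree, Fin.sum_univ_two, blockProb, add_comm]

lemma blockProb_nonneg (i j : Fin 2) : 0 ≤ blockProb p q z i j := by
  unfold blockProb; split_ifs
  exacts [p.2.1, q.2.1, z.2.1]

lemma blockProb_le_one (i j : Fin 2) : blockProb p q z i j ≤ 1 := by
  unfold blockProb; split_ifs
  exacts [p.2.2, q.2.2, z.2.2]

lemma blockDegree_le (i : Fin 2) : blockDegree p q z i ≤ 2 := by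
  unfold blockDegree
  rw [Fin.sum_univ_two]
  linarith [blockProb_le_one p q z i 0, blockProb_le_one p q z i 1]

variable {p q z}

lemma le_blockDegree (hzq : z < q) (hqp : q < p) (i : Fin 2) :
    2 * (z : ℝ) ≤ blockDegree p q z i := by
  have h1 : (z : ℝ) < q := hzq
  have h2 : (q : ℝ) < p := hqp
  fin_cases i
  · simp only [Fin.zero_eta, blockDegree_zero]; linarith
  · simp only [Fin.mk_one, blockDegree_one]; linarith

end Block

/-! ### Degrees and quadratic forms in typical graphs. -/

section Degree

variable {N : ℕ} {p q z : unitInterval}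

lemma edgeProb_mk (u v : Node N) :
    (edgeProb N p q z s(u, v) : ℝ) = blockProb p q z (label u) (label v) := by
  simp only [edgeProb, Sym2.lift_mk, blockProb]
  split_ifs <;> rfl

lemma adjacencyMatrix_eq (G : LoopGraph N) (u v : Node N) :
    adjacencyMatrix G u v = blockProb p q z (label u) (label v) + edgeNoise p q z G s(u, v) := by
  rw [← edgeProb_mk]
  simp [adjacencyMatrix, edgeNoise]

lemma adjacencyMatrix_comm (G : LoopGraph N) (u v : Node N) :
    adjacencyMatrix G u v = adjacencyMatrix G v u := by
  simp [adjacencyMatrix, Sym2.eq_swap]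

lemma sum_adjacencyMatrix_mul (G : LoopGraph N) (v : Node N) (y : Node N → ℝ) :
    ∑ u, adjacencyMatrix G v u * y u =
      ∑ j, blockProb p q z (label v) j * ∑ k : Fin N, y (j, k) +
        ∑ u, edgeNoise p q z G s(v, u) * y u := by
  simp only [adjacencyMatrix_eq (p := p) (q := q) (z := z), add_mul, Finset.sum_add_distrib]
  congr 1
  rw [Fintype.sum_prod_type]
  simp only [Finset.mul_sum]
  rfl

namespace IsTypical

variable {δ : ℝ} {G : LoopGraph N} (h : IsTypical p q z δ G)
include h

lemma abs_nodeDegree_sub_le (v : Node N) :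
    |nodeDegree G v - N * blockDegree p q z (label v)| ≤ 2 * δ * N := by
  have h1 : nodeDegree G v = N * blockDegree p q z (label v) +
      ∑ i, ∑ k : Fin N, edgeNoise p q z G s(v, (i, k)) := by
    have := sum_adjacencyMatrix_mul (p := p) (q := q) (z := z) G v (fun _ => 1)
    simp only [mul_one] at this
    rw [nodeDegree, this, Fintype.sum_prod_type, ← Finset.sum_mul, blockDegree]
    simp [mul_comm]
  rw [h1, add_sub_cancel_left, Fin.sum_univ_two]
  have := abs_add_le (∑ k : Fin N, edgeNoise p q z G s(v, (0, k)))
    (∑ k : Fin N, edgeNoise p q z G s(v, (1, k)))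
  linarith [h.abs_rowSum_le v 0, h.abs_rowSum_le v 1]

lemma le_nodeDegree (hzq : z < q) (hqp : q < p) (hδ : 2 * δ ≤ z) (v : Node N) :
    (z : ℝ) * N ≤ nodeDegree G v := by
  have h1 := (abs_le.1 (h.abs_nodeDegree_sub_le v)).1
  have h2 := le_blockDegree hzq hqp (label v)
  have hN : (0 : ℝ) ≤ N := Nat.cast_nonneg N
  nlinarith

lemma nodeDegree_le (hδ : 2 * δ ≤ z) (v : Node N) : nodeDegree G v ≤ 3 * N := by
  have h1 := (abs_le.1 (h.abs_nodeDegree_sub_le v)).2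
  have h2 := blockDegree_le p q z (label v)
  have h3 : (z : ℝ) ≤ 1 := z.2.2
  have hN : (0 : ℝ) ≤ N := Nat.cast_nonneg N
  nlinarith

lemma abs_sum_mul_noise_le (hδ : 0 ≤ δ) (y : Node N → ℝ) :
    |∑ v, y v * ∑ u, edgeNoise p q z G s(v, u) * y u| ≤ δ * N * ∑ u, y u ^ 2 := by
  have h1 := Finset.sum_mul_sq_le_sq_mul_sq Finset.univ y
    (fun v => ∑ u, edgeNoise p q z G s(v, u) * y u)
  have h2 : 0 ≤ ∑ u, y u ^ 2 := by positivity
  refine abs_le_of_sq_le_sq ?_ (by positivity)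
  refine h1.trans ((mul_le_mul_of_nonneg_left (h.sum_sq_le y) h2).trans (le_of_eq ?_))
  ring

end IsTypical

end Degree

/-! ### The second eigenvalue stays away from 1. -/

section Spectral

variable {N : ℕ} {p q z : unitInterval}

lemma laplacian_mulVec (G : LoopGraph N) (x : Node N → ℝ) (v : Node N) :
    (laplacian G).mulVec x v = x v - (√(nodeDegree G v))⁻¹ *
      ∑ u, adjacencyMatrix G v u * ((√(nodeDegree G u))⁻¹ * x u) := by
  rw [laplacian, Matrix.sub_mulVec, Matrix.one_mulVec, ← Matrix.mulVec_mulVec,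
    ← Matrix.mulVec_mulVec, Pi.sub_apply, Matrix.mulVec_diagonal]
  simp only [Matrix.mulVec, dotProduct]
  simp [Matrix.diagonal_apply, Finset.sum_ite_eq]

lemma laplacian_transpose (G : LoopGraph N) : (laplacian G).transpose = laplacian G := by
  have h : (adjacencyMatrix G).transpose = adjacencyMatrix G := by
    ext u v; exact adjacencyMatrix_comm G v u
  simp [laplacian, Matrix.transpose_mul, h, Matrix.mul_assoc]

/-- The substitution `x = D^{1/2} y` turns the Laplacian form into that of `D - A`, free of square
roots. -/
lemma sum_mul_laplacian_sqrt (G : LoopGraph N) (hd : ∀ v, 0 < nodeDegree G v) (y : Node N → ℝ) :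
    (fun v => √(nodeDegree G v) * y v) ⬝ᵥ
      (laplacian G).mulVec (fun v => √(nodeDegree G v) * y v) =
    ∑ v, nodeDegree G v * y v ^ 2 - ∑ v, y v * ∑ u, adjacencyMatrix G v u * y u := by
  rw [dotProduct, ← Finset.sum_sub_distrib]
  refine Finset.sum_congr rfl fun v _ => ?_
  rw [laplacian_mulVec]
  have hs : ∀ v, √(nodeDegree G v) ≠ 0 := fun v => (Real.sqrt_pos.2 (hd v)).ne'
  simp only [inv_mul_cancel_left₀ (hs _)]
  have h1 := Real.sq_sqrt (hd v).le
  have h2 := hs v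
  field_simp
  rw [h1]
  ring

/-- The Rayleigh bound for the second eigenvalue: the quadratic form, on a vector orthogonal to
the first vector of a sorted eigenbasis, is at least the second eigenvalue times the square norm. -/
lemma second_eigenvalue_mul_le {M : Matrix (Node N) (Node N) ℝ} (hM : M.transpose = M)
    (b : NodeBasis N) (μ : Fin (Fintype.card (Node N)) → ℝ) (hμ : Monotone μ)
    (hb : ∀ i u, M.mulVec (fun w => b i w) u = μ i * b i u)
    (i₀ i₁ : Fin (Fintype.card (Node N))) (h₀ : (i₀ : ℕ) = 0) (h₁ : (i₁ : ℕ) = 1)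
    (x : Node N → ℝ) (hx : (fun w => b i₀ w) ⬝ᵥ x = 0) :
    μ i₁ * (x ⬝ᵥ x) ≤ x ⬝ᵥ M.mulVec x := by
  have hinner : ∀ a c : Node N → ℝ, a ⬝ᵥ c =
      ∑ i, ((fun w => b i w) ⬝ᵥ a) * ((fun w => b i w) ⬝ᵥ c) := by
    intro a c
    have := b.sum_inner_mul_inner (WithLp.toLp 2 a) (WithLp.toLp 2 c)
    simp only [PiLp.inner_apply, RCLike.inner_apply, conj_trivial] at this
    simp only [dotProduct]
    rw [Finset.sum_congr rfl fun i _ => mul_comm (a i) (c i), ← this]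
    refine Finset.sum_congr rfl fun i _ => ?_
    simp only [mul_comm]
  have hMb : ∀ i, (fun w => b i w) ⬝ᵥ M.mulVec x = μ i * ((fun w => b i w) ⬝ᵥ x) := by
    intro i
    rw [Matrix.dotProduct_mulVec, ← Matrix.mulVec_transpose, hM,
      show M.mulVec (fun w => b i w) = μ i • (fun w => b i w) from funext fun u => hb i u,
      smul_dotProduct, smul_eq_mul]
  rw [hinner x x, hinner x (M.mulVec x), Finset.mul_sum]
  refine Finset.sum_le_sum fun i _ => ?_
  rw [hMb]
  rcases Nat.eq_zero_or_pos (i : ℕ) with hi | hi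
  · have : i = i₀ := Fin.ext (hi.trans h₀.symm)
    rw [this, hx]; simp
  · have : μ i₁ ≤ μ i := hμ (Fin.le_def.2 (by omega))
    nlinarith [mul_self_nonneg ((fun w => b i w) ⬝ᵥ x)]

/-- On functions of the label, the form of `B` is at least `(q - z) N² |t|²`. The noise costs at
most half of that, and the degree form is at most `3 N² |t|²`; hence the constant `(q - z)/6`. -/
lemma IsTypical.rayleigh_le {δ : ℝ} {G : LoopGraph N} (h : IsTypical p q z δ G)
    (hz : 0 < z) (hzq : z < q) (hqp : q < p) (hδ : 0 ≤ δ) (hδz : 2 * δ ≤ z)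
    (hδq : 2 * δ ≤ q - z) (hN : 0 < N) (t : Fin 2 → ℝ) :
    ∑ v, nodeDegree G v * t (label v) ^ 2 -
        ∑ v, t (label v) * ∑ u, adjacencyMatrix G v u * t (label u) ≤
      (1 - (q - z) / 6) * ∑ v, nodeDegree G v * t (label v) ^ 2 := by
  have hN' : (0 : ℝ) < N := by exact_mod_cast hN
  have hqp' : (q : ℝ) < p := hqp
  have hz' : (0 : ℝ) < z := hz
  have hsq : ∑ v : Node N, t (label v) ^ 2 = N * (t 0 ^ 2 + t 1 ^ 2) := by
    rw [Fintype.sum_prod_type]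
    simp [label]
    ring
  have hmain : ∑ v : Node N, t (label v) * ∑ u, adjacencyMatrix G v u * t (label u) =
      N ^ 2 * (p * t 0 ^ 2 + q * t 1 ^ 2 + 2 * z * (t 0 * t 1)) +
      ∑ v, t (label v) * ∑ u, edgeNoise p q z G s(v, u) * t (label u) := by
    simp only [sum_adjacencyMatrix_mul (p := p) (q := q) (z := z), mul_add,
      Finset.sum_add_distrib]
    congr 1
    rw [Fintype.sum_prod_type]
    simp [label, blockProb]
    ring
  have hnoise := (abs_le.1 (h.abs_sum_mul_noise_le hδ (fun v => t (label v)))).1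
  rw [hsq] at hnoise
  have hdeg : ∑ v, nodeDegree G v * t (label v) ^ 2 ≤ 3 * N * (N * (t 0 ^ 2 + t 1 ^ 2)) := by
    rw [← hsq, Finset.mul_sum]
    exact Finset.sum_le_sum fun v _ =>
      mul_le_mul_of_nonneg_right (h.nodeDegree_le hδz v) (sq_nonneg _)
  rw [hmain]
  have hquad : (q - z : ℝ) * (t 0 ^ 2 + t 1 ^ 2) ≤
      p * t 0 ^ 2 + q * t 1 ^ 2 + 2 * z * (t 0 * t 1) := by
    nlinarith [mul_nonneg hz'.le (sq_nonneg (t 0 + t 1)),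
      mul_nonneg (sub_nonneg.2 hqp'.le) (sq_nonneg (t 0))]
  have h4 : N ^ 2 * ((q - z : ℝ) * (t 0 ^ 2 + t 1 ^ 2)) ≤
      N ^ 2 * (p * t 0 ^ 2 + q * t 1 ^ 2 + 2 * z * (t 0 * t 1)) :=
    mul_le_mul_of_nonneg_left hquad (by positivity)
  have h5 : 2 * δ * (N ^ 2 * (t 0 ^ 2 + t 1 ^ 2)) ≤ (q - z) * (N ^ 2 * (t 0 ^ 2 + t 1 ^ 2)) :=
    mul_le_mul_of_nonneg_right hδq (by positivity)
  have h6 := mul_le_mul_of_nonneg_left hdeg (sub_nonneg.2 (show (z : ℝ) ≤ q from hzq.le))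
  nlinarith

/-- The degree-weighted functions of the label form a two-dimensional space, so it contains a
nonzero vector orthogonal to the first eigenvector, which serves as a test vector. -/
lemma IsTypical.second_eigenvalue_le {δ : ℝ} {G : LoopGraph N} (h : IsTypical p q z δ G)
    (hz : 0 < z) (hzq : z < q) (hqp : q < p) (hδ : 0 ≤ δ) (hδz : 2 * δ ≤ z)
    (hδq : 2 * δ ≤ q - z) (hN : 0 < N)
    (b : NodeBasis N) (μ : Fin (Fintype.card (Node N)) → ℝ) (hμ : Monotone μ)
    (hb : ∀ i u, (laplacian G).mulVec (fun w => b i w) u = μ i * b i u)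
    (i₀ i₁ : Fin (Fintype.card (Node N))) (h₀ : (i₀ : ℕ) = 0) (h₁ : (i₁ : ℕ) = 1) :
    μ i₁ ≤ 1 - (q - z) / 6 := by
  have hN' : (0 : ℝ) < N := by exact_mod_cast hN
  have hz' : (0 : ℝ) < z := hz
  have hd : ∀ v, 0 < nodeDegree G v := fun v =>
    lt_of_lt_of_le (by positivity) (h.le_nodeDegree hzq hqp hδz v)
  let c : Fin 2 → ℝ := fun i => ∑ k : Fin N, b i₀ (i, k) * √(nodeDegree G (i, k))
  obtain ⟨t, ht, hct⟩ : ∃ t : Fin 2 → ℝ, t ≠ 0 ∧ c 0 * t 0 + c 1 * t 1 = 0 := by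
    by_cases hc : c 0 = 0
    · exact ⟨![1, 0], fun h => by simpa using congrFun h 0, by simp [hc]⟩
    · exact ⟨![-c 1, c 0], fun h => hc (by simpa using congrFun h 1), by simp; ring⟩
  have hpos : 0 < ∑ v, nodeDegree G v * t (label v) ^ 2 := by
    obtain ⟨i, hi⟩ : ∃ i, t i ≠ 0 := by
      by_contra hcon; push Not at hcon; exact ht (funext hcon)
    refine Finset.sum_pos' (fun v _ => mul_nonneg (hd v).le (sq_nonneg _))
      ⟨(i, ⟨0, hN⟩), Finset.mem_univ _, mul_pos (hd _) ?_⟩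
    exact pow_pos (lt_of_le_of_ne (sq_nonneg _) (Ne.symm (pow_ne_zero 2 hi))) 1 |>.trans_eq
      (pow_one _)
  have hx : (fun w => b i₀ w) ⬝ᵥ (fun v => √(nodeDegree G v) * t (label v)) = 0 := by
    rw [dotProduct, Fintype.sum_prod_type, Fin.sum_univ_two, ← hct, Finset.sum_mul, Finset.sum_mul]
    congr 1 <;> refine Finset.sum_congr rfl fun k _ => ?_ <;> simp only [label] <;> ring
  have h1 := second_eigenvalue_mul_le (laplacian_transpose G) b μ hμ hb i₀ i₁ h₀ h₁ _ hx
  rw [sum_mul_laplacian_sqrt G hd] at h1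
  have h2 : (fun v => √(nodeDegree G v) * t (label v)) ⬝ᵥ
      (fun v => √(nodeDegree G v) * t (label v)) = ∑ v, nodeDegree G v * t (label v) ^ 2 := by
    refine Finset.sum_congr rfl fun v _ => ?_
    rw [mul_mul_mul_comm, Real.mul_self_sqrt (hd v).le, sq]
  rw [h2] at h1
  have h3 := h1.trans (h.rayleigh_le hz hzq hqp hδ hδz hδq hN t)
  exact le_of_mul_le_mul_right h3 hpos

end Spectral

/-! ### Entrywise closeness of an eigenvector to a block-constant function. -/

section Embedding

variable {N : ℕ} {p q z : unitInterval}

/-- The operator norm first gives closeness in mean square. Feeding this back into the eigenvector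
equation, together with the row-sum bounds, upgrades it to a uniform bound. The lower bound `κ` on
`θ` allows division by `θ`. -/
lemma IsTypical.exists_block_close {δ : ℝ} {G : LoopGraph N} (h : IsTypical p q z δ G)
    (hz : 0 < z) (hzq : z < q) (hqp : q < p) (hδ : 0 ≤ δ) (hδz : 2 * δ ≤ z)
    (hN : 0 < N) {κ θ : ℝ} (hκ : 0 < κ) (hκ1 : κ ≤ 1) (hθ : κ ≤ θ) (g : Node N → ℝ)
    (hg : ∑ v, nodeDegree G v * g v ^ 2 = N ^ 2)
    (hθg : ∀ v, θ * nodeDegree G v * g v = ∑ u, adjacencyMatrix G v u * g u) :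
    ∃ s : Fin 2 → ℝ, (∀ v, |g v - s (label v)| ≤ 10 / (κ ^ 2 * z ^ 4) * δ) ∧
      (∀ i, |s i| ≤ 1 / (κ * z ^ 2)) ∧
      (∀ i, |θ * blockDegree p q z i * s i| ≤ 2 / z) ∧
      (∀ i, |θ * blockDegree p q z i * s i - ∑ j, blockProb p q z i j * s j| ≤
        2 * (10 / (κ ^ 2 * z ^ 4) * δ)) := by
  have hN' : (0 : ℝ) < N := by exact_mod_cast hN
  have hz' : (0 : ℝ) < z := hz
  have hz1 : (z : ℝ) ≤ 1 := z.2.2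
  have hθ0 : 0 < θ := hκ.trans_le hθ
  have hD : ∀ i, 2 * (z : ℝ) ≤ blockDegree p q z i := le_blockDegree hzq hqp
  have hD0 : ∀ i, 0 < blockDegree p q z i := fun i => lt_of_lt_of_le (by positivity) (hD i)
  have hgsq : ∑ v, g v ^ 2 ≤ N / z := by
    rw [le_div_iff₀ hz']
    have h1 : (z : ℝ) * N * ∑ v, g v ^ 2 ≤ N ^ 2 := by
      rw [← hg, Finset.mul_sum]
      exact Finset.sum_le_sum fun v _ =>
        mul_le_mul_of_nonneg_right (h.le_nodeDegree hzq hqp hδz v) (sq_nonneg _)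
    nlinarith
  set Y : Fin 2 → ℝ := fun j => (∑ k : Fin N, g (j, k)) / N with hY
  have hYle : ∀ j, |Y j| ≤ 1 / z := by
    intro j
    have h1 := sq_sum_le_card_mul_sum_sq (s := Finset.univ) (f := fun k : Fin N => g (j, k))
    have h2 : ∑ k : Fin N, g (j, k) ^ 2 ≤ ∑ v, g v ^ 2 := by
      rw [Fintype.sum_prod_type]
      exact Finset.single_le_sum (f := fun j => ∑ k : Fin N, g (j, k) ^ 2)
        (fun _ _ => by positivity) (Finset.mem_univ j)
    simp only [Finset.card_univ, Fintype.card_fin] at h1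
    refine abs_le_of_sq_le_sq ?_ (by positivity)
    rw [hY]
    simp only [div_pow]
    rw [div_le_div_iff₀ (by positivity) (by positivity)]
    have h3 : (∑ k : Fin N, g (j, k)) ^ 2 ≤ N * (N / z) :=
      h1.trans (mul_le_mul_of_nonneg_left (h2.trans hgsq) hN'.le)
    calc (∑ k : Fin N, g (j, k)) ^ 2 * z ^ 2 ≤ N * (N / z) * z ^ 2 :=
          mul_le_mul_of_nonneg_right h3 (by positivity)
      _ = N ^ 2 * z := by field_simp
      _ ≤ 1 ^ 2 * N ^ 2 := by nlinarith [sq_nonneg (N : ℝ)]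
  set T : Fin 2 → ℝ := fun i => ∑ j, blockProb p q z i j * Y j with hT
  have hTle : ∀ i, |T i| ≤ 2 / z := by
    intro i
    have h1 : ∀ j, |blockProb p q z i j * Y j| ≤ 1 / z := by
      intro j
      rw [abs_mul, abs_of_nonneg (blockProb_nonneg _ _ _ _ _)]
      exact (mul_le_of_le_one_left (abs_nonneg _) (blockProb_le_one _ _ _ _ _)).trans (hYle j)
    refine (Finset.abs_sum_le_sum_abs _ _).trans ((Finset.sum_le_sum fun j _ => h1 j).trans ?_)
    rw [Fin.sum_univ_two]
    apply le_of_eq; ring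
  -- The value that the eigenvector equation would give with the noise dropped and the degree
  -- replaced by its expectation.
  set s : Fin 2 → ℝ := fun i => T i / (θ * blockDegree p q z i) with hs
  have hsT : ∀ i, θ * blockDegree p q z i * s i = T i := by
    intro i
    have := (hD0 i).ne'
    rw [hs]; field_simp
  have hsle : ∀ i, |s i| ≤ 1 / (κ * z ^ 2) := by
    intro i
    rw [hs]
    simp only [abs_div]
    rw [abs_of_pos (mul_pos hθ0 (hD0 i))]
    have h1 : κ * (2 * z) ≤ θ * blockDegree p q z i :=
      mul_le_mul hθ (hD i) (by positivity) hθ0.le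
    calc |T i| / (θ * blockDegree p q z i) ≤ (2 / z) / (κ * (2 * z)) :=
          div_le_div₀ (by positivity) (hTle i) (by positivity) h1
      _ = _ := by field_simp
  set r : Node N → ℝ := fun v => (∑ u, edgeNoise p q z G s(v, u) * g u) / N with hr
  have heq : ∀ v, θ * nodeDegree G v * g v = N * T (label v) + N * r v := by
    intro v
    rw [hθg, sum_adjacencyMatrix_mul (p := p) (q := q) (z := z)]
    simp only [hT, hY, hr, Finset.mul_sum]
    congr 1
    · refine Finset.sum_congr rfl fun j _ => ?_
      rw [← Finset.mul_sum]
      field_simp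
    · field_simp
  have hclose : ∀ v, κ * z * |g v - s (label v)| ≤ |r v| + 2 * δ / z ^ 2 := by
    intro v
    set i := label v
    have h1 : θ * (nodeDegree G v / N) * (g v - s i) =
        r v - T i * ((nodeDegree G v / N - blockDegree p q z i) / blockDegree p q z i) := by
      have h2 := heq v
      have h3 := hsT i
      have h4 := (hD0 i).ne'
      have h5 : s i = T i / (θ * blockDegree p q z i) := rfl
      rw [h5]
      field_simp
      linear_combination (blockDegree p q z i) * h2
    have h2 : κ * z ≤ θ * (nodeDegree G v / N) :=
      mul_le_mul hθ ((le_div_iff₀ hN').2 (h.le_nodeDegree hzq hqp hδz v)) hz'.le hθ0.le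
    have h3 : |(nodeDegree G v / N - blockDegree p q z i) / blockDegree p q z i| ≤ δ / z := by
      rw [abs_div, abs_of_pos (hD0 i)]
      have h4 : |nodeDegree G v / N - blockDegree p q z i| ≤ 2 * δ := by
        have h5 : nodeDegree G v / N - blockDegree p q z i =
            (nodeDegree G v - N * blockDegree p q z i) / N := by field_simp
        rw [h5, abs_div, abs_of_pos hN', div_le_iff₀ hN']
        exact h.abs_nodeDegree_sub_le v
      calc _ ≤ 2 * δ / (2 * z) := div_le_div₀ (by positivity) h4 (by positivity) (hD i)
        _ = _ := by field_simp
    calc κ * z * |g v - s i| ≤ θ * (nodeDegree G v / N) * |g v - s i| :=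
          mul_le_mul_of_nonneg_right h2 (abs_nonneg _)
      _ = |r v - T i * ((nodeDegree G v / N - blockDegree p q z i) / blockDegree p q z i)| := by
          rw [← h1, abs_mul, abs_of_nonneg (le_trans (by positivity) h2)]
      _ ≤ |r v| + |T i * ((nodeDegree G v / N - blockDegree p q z i) / blockDegree p q z i)| :=
          abs_sub _ _
      _ ≤ |r v| + 2 / z * (δ / z) := by
          rw [abs_mul]
          gcongr
          exact hTle i
      _ = _ := by field_simp
  have hrsq : ∑ v, r v ^ 2 ≤ δ ^ 2 * (N / z) := by
    have h1 := h.sum_sq_le g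
    have h2 : ∑ v, r v ^ 2 = (∑ v, (∑ u, edgeNoise p q z G s(v, u) * g u) ^ 2) / N ^ 2 := by
      rw [Finset.sum_div]
      exact Finset.sum_congr rfl fun v _ => div_pow _ _ _
    rw [h2, div_le_iff₀ (by positivity)]
    refine h1.trans ?_
    calc (δ * N) ^ 2 * ∑ u, g u ^ 2 ≤ (δ * N) ^ 2 * (N / z) :=
          mul_le_mul_of_nonneg_left hgsq (by positivity)
      _ = _ := by ring
  -- Mean-square closeness: the remainder `r = Wg/N` is controlled in `ℓ²` by the operator norm.
  have herr : ∑ v, (g v - s (label v)) ^ 2 ≤ 18 * δ ^ 2 * N / (κ ^ 2 * z ^ 6) := by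
    have h1 : ∀ v, (κ * z) ^ 2 * (g v - s (label v)) ^ 2 ≤
        2 * r v ^ 2 + 2 * (2 * δ / z ^ 2) ^ 2 := by
      intro v
      rw [← sq_abs (g v - _), ← mul_pow, ← sq_abs (r v)]
      refine (pow_le_pow_left₀ (by positivity) (hclose v) 2).trans ?_
      nlinarith [sq_nonneg (|r v| - 2 * δ / z ^ 2)]
    have h2 : (κ * z) ^ 2 * ∑ v, (g v - s (label v)) ^ 2 ≤
        2 * (δ ^ 2 * (N / z)) + 2 * N * (2 * (2 * δ / z ^ 2) ^ 2) := by
      rw [Finset.mul_sum]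
      refine (Finset.sum_le_sum fun v _ => h1 v).trans ?_
      rw [Finset.sum_add_distrib, ← Finset.mul_sum]
      simp only [Finset.sum_const, Finset.card_univ, Fintype.card_prod, Fintype.card_fin,
        nsmul_eq_mul, Nat.cast_mul, Nat.cast_ofNat]
      linarith
    have h3 : 2 * (δ ^ 2 * (N / z)) + 2 * N * (2 * (2 * δ / z ^ 2) ^ 2) ≤
        18 * δ ^ 2 * N / z ^ 4 := by
      have h4 : (N : ℝ) / z ≤ N / z ^ 4 :=
        div_le_div_of_nonneg_left hN'.le (by positivity)
          (pow_le_of_le_one hz'.le hz1 (by norm_num))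
      have h5 : 18 * δ ^ 2 * N / z ^ 4 = 2 * (δ ^ 2 * (N / z ^ 4)) +
          2 * N * (2 * (2 * δ / z ^ 2) ^ 2) := by field_simp; ring
      rw [h5]
      gcongr
    have h6 : (∑ v, (g v - s (label v)) ^ 2) * (κ * z) ^ 2 ≤ 18 * δ ^ 2 * N / z ^ 4 := by
      rw [mul_comm]; exact h2.trans h3
    calc _ ≤ (18 * δ ^ 2 * N / z ^ 4) / (κ * z) ^ 2 := (le_div_iff₀ (by positivity)).2 h6
      _ = _ := by field_simp
  -- Bootstrap: split `Wg = Ws + W(g - s)`. Row sums bound each entry of the first term;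
  -- Cauchy–Schwarz with the mean-square error bounds the second.
  have hrle : ∀ v, |r v| ≤ 8 * δ / (κ * z ^ 3) := by
    intro v
    have h1 : ∑ u, edgeNoise p q z G s(v, u) * g u =
        ∑ j, s j * ∑ k : Fin N, edgeNoise p q z G s(v, (j, k)) +
        ∑ u, edgeNoise p q z G s(v, u) * (g u - s (label u)) := by
      simp only [mul_sub, Finset.sum_sub_distrib, Fintype.sum_prod_type, label, Finset.mul_sum]
      simp only [mul_comm (s _)]
      ring
    have h2 : |∑ j, s j * ∑ k : Fin N, edgeNoise p q z G s(v, (j, k))| ≤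
        2 * (1 / (κ * z ^ 2) * (δ * N)) := by
      refine (Finset.abs_sum_le_sum_abs _ _).trans ?_
      have h3 : ∀ j, |s j * ∑ k : Fin N, edgeNoise p q z G s(v, (j, k))| ≤
          1 / (κ * z ^ 2) * (δ * N) := by
        intro j
        rw [abs_mul]
        exact mul_le_mul (hsle j) (h.abs_rowSum_le v j) (abs_nonneg _) (by positivity)
      refine (Finset.sum_le_sum fun j _ => h3 j).trans (le_of_eq ?_)
      rw [Fin.sum_univ_two]; ring
    have h4 : |∑ u, edgeNoise p q z G s(v, u) * (g u - s (label u))| ≤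
        6 * δ * N / (κ * z ^ 3) := by
      refine abs_le_of_sq_le_sq ?_ (by positivity)
      refine (Finset.sum_mul_sq_le_sq_mul_sq _ _ _).trans ?_
      have h5 : ∑ u, edgeNoise p q z G s(v, u) ^ 2 ≤ 2 * N := by
        refine (Finset.sum_le_sum fun u _ =>
          (sq_le_one_iff_abs_le_one _).2 (abs_edgeNoise_le p q z G s(v, u))).trans ?_
        simp
      refine (mul_le_mul h5 herr (by positivity) (by positivity)).trans (le_of_eq ?_)
      field_simp; ring
    have h6 : |r v| = |∑ u, edgeNoise p q z G s(v, u) * g u| / N := by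
      rw [hr]; simp only [abs_div, abs_of_pos hN']
    rw [h6, h1, div_le_iff₀ hN']
    refine (abs_add_le _ _).trans ((add_le_add h2 h4).trans ?_)
    have h7 : 1 / (κ * z ^ 2) ≤ 1 / (κ * z ^ 3) :=
      one_div_le_one_div_of_le (by positivity)
        (mul_le_mul_of_nonneg_left (pow_le_pow_of_le_one hz'.le hz1 (by norm_num)) hκ.le)
    have h8 : 8 * δ / (κ * z ^ 3) * N =
        2 * (1 / (κ * z ^ 3) * (δ * N)) + 6 * δ * N / (κ * z ^ 3) := by field_simp; ring
    rw [h8]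
    gcongr
  have hfinal : ∀ v, |g v - s (label v)| ≤ 10 / (κ ^ 2 * z ^ 4) * δ := by
    intro v
    have h1 := (hclose v).trans (add_le_add_left (hrle v) _)
    have h2 : 2 * δ / z ^ 2 ≤ 2 * δ / (κ * z ^ 3) := by
      refine div_le_div_of_nonneg_left (by positivity) (by positivity) ?_
      calc κ * z ^ 3 ≤ 1 * z ^ 3 := mul_le_mul_of_nonneg_right hκ1 (by positivity)
        _ ≤ z ^ 2 := by rw [one_mul]; exact pow_le_pow_of_le_one hz'.le hz1 (by norm_num)
    have h3 : |g v - s (label v)| * (κ * z) ≤ 10 * δ / (κ * z ^ 3) := by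
      rw [mul_comm]
      refine h1.trans ((add_le_add_right h2 _).trans (le_of_eq ?_))
      ring
    calc _ ≤ 10 * δ / (κ * z ^ 3) / (κ * z) := (le_div_iff₀ (by positivity)).2 h3
      _ = _ := by field_simp
  refine ⟨s, hfinal, hsle, fun i => by rw [hsT]; exact hTle i, fun i => ?_⟩
  -- The block averages of `g` are as close to `s` as its entries are, so replacing them by `s` in
  -- `T` gives the approximate 2×2 equation.
  have hYs : ∀ j, |Y j - s j| ≤ 10 / (κ ^ 2 * z ^ 4) * δ := by
    intro j
    have h1 : Y j - s j = (∑ k : Fin N, (g (j, k) - s j)) / N := by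
      rw [Finset.sum_sub_distrib, hY]
      simp
      field_simp
    rw [h1, abs_div, abs_of_pos hN', div_le_iff₀ hN']
    refine (Finset.abs_sum_le_sum_abs _ _).trans
      ((Finset.sum_le_sum fun k _ => hfinal (j, k)).trans (le_of_eq ?_))
    simp [mul_comm]
  rw [hsT, hT]
  simp only [← Finset.sum_sub_distrib, ← mul_sub]
  refine (Finset.abs_sum_le_sum_abs _ _).trans ?_
  have h1 : ∀ j, |blockProb p q z i j * (Y j - s j)| ≤ 10 / (κ ^ 2 * z ^ 4) * δ := by
    intro j
    rw [abs_mul, abs_of_nonneg (blockProb_nonneg _ _ _ _ _)]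
    exact (mul_le_of_le_one_left (abs_nonneg _) (blockProb_le_one _ _ _ _ _)).trans (hYs j)
  refine (Finset.sum_le_sum fun j _ => h1 j).trans (le_of_eq ?_)
  rw [Fin.sum_univ_two]; ring

end Embedding

/-- An approximate eigenvector `(a x, b y)` of the symmetric `2 × 2` matrix with diagonal
`p / a², q / b²` and off-diagonal `z / (a b)`, where `a² = p + z` and `b² = q + z`, has two clearly
different entries. -/
lemma eigenvector_gap {p q z θ x y E : ℝ} (hz : 0 < z) (hz1 : z ≤ 1) (hzq : z < q) (hqp : q < p)
    (hp : p ≤ 1)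
    (hθ : 0 ≤ θ) (hx : |θ * (p + z) * x| ≤ 2 / z) (hy : |θ * (q + z) * y| ≤ 2 / z)
    (hxE : |θ * (p + z) * x - (p * x + z * y)| ≤ E)
    (hyE : |θ * (q + z) * y - (z * x + q * y)| ≤ E)
    (hxy : 1 / 5 ≤ |x| ∨ 1 / 5 ≤ |y|) (hE : E ≤ z ^ 3 * (p - q) / 80) :
    z ^ 4 * (p - q) / 280 ≤ |√(p + z) * x - √(q + z) * y| := by
  have hE0 : 0 ≤ E := (abs_nonneg _).trans hxE
  have hroot : ∀ {r : ℝ}, z < r → z ≤ √(r + z) ∧ √(r + z) ^ 2 = r + z := fun {r} hr =>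
    ⟨Real.le_sqrt_of_sq_le (by nlinarith), Real.sq_sqrt (by linarith)⟩
  obtain ⟨ha, ha2⟩ := hroot (hzq.trans hqp)
  obtain ⟨hb, hb2⟩ := hroot hzq
  set a := √(p + z)
  set b := √(q + z)
  have ha0 : 0 < a := hz.trans_le ha
  have hb0 : 0 < b := hz.trans_le hb
  -- One entry being bounded below turns the bounds on `θ(p+z)x` and `θ(q+z)y` into an upper bound
  -- for `θ`.
  have hθle : θ ≤ 5 / z ^ 2 := by
    have key : ∀ r w : ℝ, z < r → |θ * (r + z) * w| ≤ 2 / z → 1 / 5 ≤ |w| → θ ≤ 5 / z ^ 2 := by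
      intro r w hr hw hw5
      have hrz : 0 ≤ r + z := by linarith
      rw [abs_mul, abs_of_nonneg (mul_nonneg hθ hrz)] at hw
      have h1 : θ * (2 * z) * (1 / 5) ≤ 2 / z := by
        refine le_trans ?_ hw
        gcongr
        linarith
      rw [le_div_iff₀ (by positivity)]
      rw [le_div_iff₀ hz] at h1
      linarith
    rcases hxy with h | h
    · exact key p x (hzq.trans hqp) hx h
    · exact key q y hzq hy h
  set e₀ := θ * (p + z) * x - (p * x + z * y) with he₀
  set e₁ := θ * (q + z) * y - (z * x + q * y) with he₁
  set Δ := a * x - b * y with hΔ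
  set ρ := p / a ^ 2 - q / b ^ 2 with hρ
  have hρle : z * (p - q) / 4 ≤ ρ := by
    rw [hρ, ha2, hb2, div_sub_div _ _ (by linarith) (by linarith), div_le_div_iff₀ (by norm_num)
      (mul_pos (by linarith) (by linarith))]
    have h1 : (p + z) * (q + z) ≤ 4 := by nlinarith
    have h2 : 0 ≤ z * (p - q) := mul_nonneg hz.le (by linarith)
    nlinarith
  -- Subtracting the two rescaled equations cancels the common part. A small `Δ` would force `ρ`
  -- times an entry to be small, yet `ρ` and one of `|x|`, `|y|` are bounded below.
  have hid₀ : ρ * (a * x) = (θ - q / b ^ 2 + z / (a * b)) * Δ - e₀ / a + e₁ / b := by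
    rw [hρ, he₀, he₁, hΔ, ← ha2, ← hb2]
    field_simp
    ring
  have hid₁ : ρ * (b * y) = (θ - p / a ^ 2 + z / (a * b)) * Δ - e₀ / a + e₁ / b := by
    have : ρ * (b * y) = ρ * (a * x) - ρ * Δ := by rw [hΔ]; ring
    rw [this, hid₀, hρ]
    ring
  have hab : z / (a * b) ≤ 1 := by
    rw [div_le_one (by positivity)]
    nlinarith
  have hab0 : 0 ≤ z / (a * b) := by positivity
  have hbound : ∀ c, 0 ≤ c → c ≤ 1 →
      |(θ - c + z / (a * b)) * Δ - e₀ / a + e₁ / b| ≤ 6 / z ^ 2 * |Δ| + 2 * E / z := by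
    intro c hc0 hc1
    have h1 : |(θ - c + z / (a * b)) * Δ| ≤ 6 / z ^ 2 * |Δ| := by
      rw [abs_mul]
      refine mul_le_mul_of_nonneg_right (abs_le.2 ?_) (abs_nonneg _)
      have h2 : 1 ≤ 1 / z ^ 2 := by
        rw [le_div_iff₀ (by positivity), one_mul]
        exact pow_le_one₀ hz.le hz1
      have h3 : 6 / z ^ 2 = 5 / z ^ 2 + 1 / z ^ 2 := by ring
      constructor <;> linarith
    have h4 : |e₀ / a| ≤ E / z := by
      rw [abs_div, abs_of_pos ha0]
      exact div_le_div₀ hE0 hxE hz ha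
    have h5 : |e₁ / b| ≤ E / z := by
      rw [abs_div, abs_of_pos hb0]
      exact div_le_div₀ hE0 hyE hz hb
    have h6 := abs_add_le ((θ - c + z / (a * b)) * Δ - e₀ / a) (e₁ / b)
    have h7 := abs_sub ((θ - c + z / (a * b)) * Δ) (e₀ / a)
    have h8 : 2 * E / z = E / z + E / z := by ring
    linarith
  have hlow : z ^ 2 * (p - q) / 20 ≤ 6 / z ^ 2 * |Δ| + 2 * E / z := by
    have h1 : ∀ w d : ℝ, z ≤ d → 1 / 5 ≤ |w| → z ^ 2 * (p - q) / 20 ≤ |ρ * (d * w)| := by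
      intro w d hd hw
      have h2 : 0 ≤ z * (p - q) / 4 := div_nonneg (mul_nonneg hz.le (by linarith)) (by norm_num)
      have hρ0 := h2.trans hρle
      have hd0 := hz.le.trans hd
      rw [abs_mul, abs_mul, abs_of_nonneg hρ0, abs_of_nonneg hd0]
      calc z ^ 2 * (p - q) / 20 = z * (p - q) / 4 * (z * (1 / 5)) := by ring
        _ ≤ _ := by gcongr
    rcases hxy with h | h
    · refine (h1 x a ha h).trans ?_
      rw [hid₀]
      exact hbound _ (div_nonneg (by linarith) (by positivity))
        ((div_le_one (by positivity)).2 (by linarith))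
    · refine (h1 y b hb h).trans ?_
      rw [hid₁]
      exact hbound _ (div_nonneg (by linarith) (by positivity))
        ((div_le_one (by positivity)).2 (by linarith))
  have hEz : 2 * E / z ≤ z ^ 2 * (p - q) / 40 := by
    rw [div_le_iff₀ hz]
    linarith
  have h9 : z ^ 2 * (p - q) / 40 ≤ 6 * |Δ| / z ^ 2 := by
    have : 6 / z ^ 2 * |Δ| = 6 * |Δ| / z ^ 2 := by ring
    linarith
  rw [le_div_iff₀ (by positivity)] at h9
  have h10 : 0 ≤ z ^ 4 * (p - q) := mul_nonneg (by positivity) (by linarith)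
  linarith

/-! ### Separation of the blocks by the second eigenvector. -/

section Separation

variable {N : ℕ} {p q z : unitInterval}

lemma IsTypical.abs_sqrt_nodeDegree_sub_le {δ : ℝ} {G : LoopGraph N} (h : IsTypical p q z δ G)
    (hz : 0 < z) (hzq : z < q) (hqp : q < p) (hN : 0 < N) (v : Node N) :
    |√(nodeDegree G v / N) - √(blockDegree p q z (label v))| ≤ 2 * δ / z := by
  have hN' : (0 : ℝ) < N := by exact_mod_cast hN
  have hz' : (0 : ℝ) < z := hz
  have hz1 : (z : ℝ) ≤ 1 := z.2.2
  have hD := le_blockDegree hzq hqp (label v)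
  have hn : 0 ≤ nodeDegree G v / N := div_nonneg
    (Finset.sum_nonneg fun u _ => by simp only [adjacencyMatrix, Matrix.of_apply]; positivity)
    hN'.le
  set n := nodeDegree G v / N with hndef
  set D := blockDegree p q z (label v)
  have h1 : |n - D| ≤ 2 * δ := by
    have h5 : n - D = (nodeDegree G v - N * D) / N := by rw [hndef]; field_simp
    rw [h5, abs_div, abs_of_pos hN', div_le_iff₀ hN']
    exact h.abs_nodeDegree_sub_le v
  have h2 : z ≤ √D := Real.le_sqrt_of_sq_le (by nlinarith)
  have h3 : (√n - √D) * (√n + √D) = n - D := by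
    linear_combination Real.sq_sqrt hn - Real.sq_sqrt (show 0 ≤ D by linarith)
  rw [le_div_iff₀ hz']
  calc |√n - √D| * z ≤ |√n - √D| * (√n + √D) :=
        mul_le_mul_of_nonneg_left (by linarith [Real.sqrt_nonneg n]) (abs_nonneg _)
    _ = |n - D| := by
        rw [← h3, abs_mul, abs_of_nonneg (by positivity : 0 ≤ √n + √D)]
    _ ≤ 2 * δ := h1

/-- The second eigenvector takes well-separated values on the two blocks. -/
lemma IsTypical.second_eigenvector_separated {δ : ℝ} {G : LoopGraph N}
    (h : IsTypical p q z δ G) (hz : 0 < z) (hzq : z < q) (hqp : q < p) (hδ : 0 ≤ δ)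
    (hδz : 2 * δ ≤ z) (hδq : 2 * δ ≤ q - z)
    (hδγ : 10 / (((q - z : ℝ) / 6) ^ 2 * z ^ 4) * δ ≤ z ^ 4 * (p - q) / 3360)
    (hN : 0 < N) (b : NodeBasis N) (hb : IsSortedEigenbasis (laplacian G) b)
    (u v : Node N) (huv : label u ≠ label v) :
    z ^ 4 * (p - q) / 560 / √N ≤ |basisValue b 1 u - basisValue b 1 v| := by
  obtain ⟨μ, hμ, hb⟩ := hb
  have hN' : (0 : ℝ) < N := by exact_mod_cast hN
  have hz' : (0 : ℝ) < z := hz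
  have hz1 : (z : ℝ) ≤ 1 := z.2.2
  have hzq' : (z : ℝ) < q := hzq
  have hqp' : (q : ℝ) < p := hqp
  have hp1 : (p : ℝ) ≤ 1 := p.2.2
  have hcard : Fintype.card (Node N) = 2 * N := by simp
  have hd : ∀ v, 0 < nodeDegree G v := fun v =>
    lt_of_lt_of_le (by positivity) (h.le_nodeDegree hzq hqp hδz v)
  set i₁ : Fin (Fintype.card (Node N)) := ⟨1, by omega⟩
  have hval : ∀ v, basisValue b 1 v = b i₁ v := fun v => by
    rw [basisValue, dif_pos (by omega)]
  set κ : ℝ := (q - z) / 6 with hκdef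
  have hκ : 0 < κ := by rw [hκdef]; linarith
  have hκ1 : κ ≤ 1 := by rw [hκdef]; linarith
  have hμ1 : μ i₁ ≤ 1 - κ := h.second_eigenvalue_le hz hzq hqp hδ hδz hδq hN b μ hμ hb
    ⟨0, by omega⟩ i₁ rfl rfl
  set θ := 1 - μ i₁ with hθdef
  have hθ : κ ≤ θ := by linarith
  -- The entries of `b i₁` have typical size `N^(-1/2)` and the degrees are of order `N`, so the
  -- factor `N` brings `g` to order one.
  set g : Node N → ℝ := fun v => N * (b i₁ v / √(nodeDegree G v)) with hg
  have hs : ∀ v, √(nodeDegree G v) ≠ 0 := fun v => (Real.sqrt_pos.2 (hd v)).ne'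
  have hnorm : ∑ v, b i₁ v ^ 2 = 1 := by
    have h1 := b.orthonormal.norm_eq_one i₁
    have h2 := EuclideanSpace.norm_sq_eq (b i₁)
    rw [h1] at h2
    simpa using h2.symm
  have hgn : ∑ v, nodeDegree G v * g v ^ 2 = N ^ 2 := by
    calc ∑ v, nodeDegree G v * g v ^ 2 = ∑ v, N ^ 2 * b i₁ v ^ 2 := by
          refine Finset.sum_congr rfl fun v _ => ?_
          rw [hg]
          simp only [mul_pow, div_pow, Real.sq_sqrt (hd v).le]
          have := (hd v).ne'
          field_simp
      _ = N ^ 2 := by rw [← Finset.mul_sum, hnorm, mul_one]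
  have hgθ : ∀ v, θ * nodeDegree G v * g v = ∑ u, adjacencyMatrix G v u * g u := by
    intro v
    have h1 := hb i₁ v
    rw [laplacian_mulVec] at h1
    have h2 : ∑ u, adjacencyMatrix G v u * g u =
        N * ∑ u, adjacencyMatrix G v u * ((√(nodeDegree G u))⁻¹ * b i₁ u) := by
      rw [Finset.mul_sum]
      refine Finset.sum_congr rfl fun u _ => ?_
      rw [hg]; ring
    rw [h2]
    have h3 : ∑ u, adjacencyMatrix G v u * ((√(nodeDegree G u))⁻¹ * b i₁ u) =
        θ * √(nodeDegree G v) * b i₁ v := by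
      have h4 := hs v
      have h5 : (√(nodeDegree G v))⁻¹ *
          ∑ u, adjacencyMatrix G v u * ((√(nodeDegree G u))⁻¹ * b i₁ u) = θ * b i₁ v := by
        rw [hθdef]; linarith
      rw [inv_mul_eq_iff_eq_mul₀ h4] at h5
      rw [h5]; ring
    rw [h3, hg]
    have h4 := hs v
    have h5 := Real.sq_sqrt (hd v).le
    field_simp
    rw [h5]
    ring
  obtain ⟨s, hgs, hsle, hsT, hsE⟩ := h.exists_block_close hz hzq hqp hδ hδz hN hκ hκ1 hθ g hgn hgθ
  set η := 10 / (κ ^ 2 * z ^ 4) * δ with hη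
  have hη0 : 0 ≤ η := by positivity
  have hzpow : (z : ℝ) ^ 4 * (p - q) ≤ z ^ 3 * (p - q) :=
    mul_le_mul_of_nonneg_right (pow_le_pow_of_le_one hz'.le hz1 (by norm_num)) (by linarith)
  have hz31 : (z : ℝ) ^ 3 * (p - q) ≤ 1 :=
    mul_le_one₀ (pow_le_one₀ hz'.le hz1) (by linarith) (by linarith)
  -- Otherwise the weighted sum of squares would be at most `2N · 3N · 4/25 < N²`.
  have hlarge : ∃ v, 2 / 5 ≤ |g v| := by
    by_contra hcon
    push Not at hcon
    have h1 : ∑ v, nodeDegree G v * g v ^ 2 ≤ ∑ _v : Node N, 3 * N * (4 / 25 : ℝ) := by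
      refine Finset.sum_le_sum fun v _ => ?_
      refine mul_le_mul (h.nodeDegree_le hδz v) ?_ (sq_nonneg _) (by positivity)
      rw [← sq_abs]
      nlinarith [hcon v, abs_nonneg (g v)]
    rw [hgn] at h1
    simp at h1
    nlinarith
  obtain ⟨v₀, hv₀⟩ := hlarge
  have hlarge' : 1 / 5 ≤ |s (label v₀)| := by
    have h1 := hgs v₀
    have h2 := abs_sub_abs_le_abs_sub (g v₀) (s (label v₀))
    linarith
  have hor : 1 / 5 ≤ |s 0| ∨ 1 / 5 ≤ |s 1| := by
    rcases (Fin.exists_fin_two (p := fun i => 1 / 5 ≤ |s i|)).1 ⟨label v₀, hlarge'⟩ with h | h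
    exacts [Or.inl h, Or.inr h]
  have hgap : (z : ℝ) ^ 4 * (p - q) / 280 ≤ |√(p + z : ℝ) * s 0 - √(q + z : ℝ) * s 1| := by
    have hT0 := hsT 0
    have hT1 := hsT 1
    have hE0 := hsE 0
    have hE1 := hsE 1
    simp only [Fin.sum_univ_two, blockDegree_zero, blockDegree_one, blockProb_zero_zero,
      blockProb_zero_one, blockProb_one_zero, blockProb_one_one] at hT0 hT1 hE0 hE1
    exact eigenvector_gap hz' hz1 hzq' hqp' hp1 (hκ.le.trans hθ) hT0 hT1 hE0 hE1 hor (by linarith)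
  rw [← blockDegree_zero p q z, ← blockDegree_one p q z] at hgap
  have hclose : ∀ v, |√N * b i₁ v - √(blockDegree p q z (label v)) * s (label v)| ≤ 3 * η := by
    intro v
    have h1 : √N * b i₁ v = √(nodeDegree G v / N) * g v := by
      rw [hg, Real.sqrt_div (hd v).le]
      have h2 := hs v
      have h3 : √(N : ℝ) ≠ 0 := (Real.sqrt_pos.2 hN').ne'
      have h4 := Real.sq_sqrt hN'.le
      field_simp
      rw [h4, mul_comm]
    have h2 := h.abs_sqrt_nodeDegree_sub_le hz hzq hqp hN v
    have h3 : √(nodeDegree G v / N) ≤ 2 := by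
      refine Real.sqrt_le_iff.2 ⟨by norm_num, ?_⟩
      rw [div_le_iff₀ hN']
      have := h.nodeDegree_le hδz v
      linarith
    set n := √(nodeDegree G v / N)
    set D := √(blockDegree p q z (label v))
    have h4 : √N * b i₁ v - D * s (label v) =
        n * (g v - s (label v)) + (n - D) * s (label v) := by rw [h1]; ring
    have h5 : |n * (g v - s (label v))| ≤ 2 * η := by
      rw [abs_mul, abs_of_nonneg (Real.sqrt_nonneg _)]
      exact mul_le_mul h3 (hgs v) (abs_nonneg _) (by norm_num)
    have h6 : |(n - D) * s (label v)| ≤ η := by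
      rw [abs_mul]
      refine (mul_le_mul h2 (hsle _) (abs_nonneg _) (by positivity)).trans ?_
      have h7 : 2 * δ / z * (1 / (κ * z ^ 2)) = 2 / (κ * z ^ 3) * δ := by field_simp
      rw [h7, hη]
      refine mul_le_mul_of_nonneg_right ?_ hδ
      refine div_le_div₀ (by norm_num) (by norm_num) (by positivity) ?_
      exact mul_le_mul (pow_le_of_le_one hκ.le hκ1 (by norm_num))
        (pow_le_pow_of_le_one hz'.le hz1 (by norm_num)) (by positivity) hκ.le
    rw [h4]
    linarith [abs_add_le (n * (g v - s (label v))) ((n - D) * s (label v))]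
  have hgap' : (z : ℝ) ^ 4 * (p - q) / 280 ≤ |√(blockDegree p q z (label u)) * s (label u) -
      √(blockDegree p q z (label v)) * s (label v)| := by
    rcases (by omega : (label u = 0 ∧ label v = 1) ∨ (label u = 1 ∧ label v = 0)) with h | h
    · rw [h.1, h.2]; exact hgap
    · rw [h.1, h.2, abs_sub_comm]; exact hgap
  rw [hval, hval, div_le_iff₀ (Real.sqrt_pos.2 hN')]
  have h1 : |b i₁ u - b i₁ v| * √N = |√N * b i₁ u - √N * b i₁ v| := by
    rw [← mul_sub, abs_mul, abs_of_nonneg (Real.sqrt_nonneg _), mul_comm]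
  rw [h1]
  have h2 := hclose u
  have h3 := hclose v
  set x := √N * b i₁ u
  set y := √N * b i₁ v
  set X := √(blockDegree p q z (label u)) * s (label u)
  set Y' := √(blockDegree p q z (label v)) * s (label v)
  have h4 : |X - Y'| ≤ |x - y| + |x - X| + |y - Y'| := by
    have h5 : X - Y' = (x - y) - (x - X) + (y - Y') := by ring
    rw [h5]
    have h6 := abs_add_le ((x - y) - (x - X)) (y - Y')
    have h7 := abs_sub (x - y) (x - X)
    linarith
  -- Each of the two points costs `3η`, and `6η ≤ z⁴(p - q)/560` is half of the limiting gap `z⁴(p -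
  -- q)/280`.
  linarith

end Separation

/-- In a point configuration in the plane with bounded second moment, most points have a
positive fraction of the points within a given distance. -/
lemma exists_card_few_neighbours_le {ε η : ℝ} (hε : 0 < ε) (hη : 0 < η) :
    ∃ c : ℝ, 0 < c ∧ ∀ (ι : Type) [Fintype ι] (m : ℝ) (x y : ι → ℝ), 0 ≤ m →
      ∑ v, x v ^ 2 ≤ m → ∑ v, y v ^ 2 ≤ m →
      ({v | (({u | (x u - x v) ^ 2 + (y u - y v) ^ 2 ≤ ε ^ 2} : Set ι).ncard : ℝ) < c * m} :
        Set ι).ncard ≤ 2 * η * m := by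
  classical
  -- By Markov's inequality at most `ηm` points lie outside radius `K`. The disc meets a bounded
  -- number of cells of side `ε/2`, and points of one cell are mutual neighbours. A cell containing
  -- a point with few neighbours thus holds fewer than `cm` points, so `c = η / #cells` bounds all
  -- such points in the disc by another `ηm`.
  set K : ℝ := √(2 / η) with hK
  have hKsq : K ^ 2 = 2 / η := Real.sq_sqrt (by positivity)
  have hK0 : 0 ≤ K := Real.sqrt_nonneg _
  set M : ℤ := ⌈K * 2 / ε⌉ + 1 with hM
  set cells : Finset (ℤ × ℤ) := Finset.Icc (-M) M ×ˢ Finset.Icc (-M) M with hcells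
  have hM0 : 0 ≤ M := by
    have : 0 ≤ ⌈K * 2 / ε⌉ := Int.ceil_nonneg (by positivity)
    omega
  have hcells0 : 0 < cells.card := Finset.card_pos.2
    ⟨(0, 0), by simp [hcells, hM0]⟩
  have hR : (0 : ℝ) < cells.card := by exact_mod_cast hcells0
  refine ⟨η / cells.card, by positivity, ?_⟩
  intro ι _ m x y hm hx hy
  set c := η / cells.card with hc
  set S : Finset ι := Finset.univ.filter fun v =>
    (({u | (x u - x v) ^ 2 + (y u - y v) ^ 2 ≤ ε ^ 2} : Set ι).ncard : ℝ) < c * m with hS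
  have hSset : {v | (({u | (x u - x v) ^ 2 + (y u - y v) ^ 2 ≤ ε ^ 2} : Set ι).ncard : ℝ) < c * m}
      = (S : Set ι) := by ext v; simp [hS]
  rw [hSset, Set.ncard_coe_finset]
  set B : Finset ι := S.filter fun v => K ^ 2 < x v ^ 2 + y v ^ 2
  set R : Finset ι := S.filter fun v => ¬ K ^ 2 < x v ^ 2 + y v ^ 2
  have hsplit : B.card + R.card = S.card := Finset.card_filter_add_card_filter_not _
  have hBcard : (B.card : ℝ) ≤ η * m := by
    have h1 : (B.card : ℝ) * K ^ 2 ≤ ∑ v ∈ B, (x v ^ 2 + y v ^ 2) := by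
      rw [← nsmul_eq_mul]
      exact Finset.card_nsmul_le_sum _ _ _ fun v hv => (Finset.mem_filter.1 hv).2.le
    have h2 : ∑ v ∈ B, (x v ^ 2 + y v ^ 2) ≤ ∑ v, (x v ^ 2 + y v ^ 2) :=
      Finset.sum_le_sum_of_subset_of_nonneg (Finset.subset_univ _) fun _ _ _ => by positivity
    rw [Finset.sum_add_distrib (s := Finset.univ)] at h2
    rw [hKsq] at h1
    have h3 : (B.card : ℝ) * (2 / η) ≤ 2 * m := by linarith
    rw [mul_div_assoc', div_le_iff₀ hη] at h3
    linarith
  set f : ι → ℤ × ℤ := fun v => (⌊x v * 2 / ε⌋, ⌊y v * 2 / ε⌋) with hf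
  have hcell : ∀ t : ℝ, t ^ 2 ≤ K ^ 2 → ⌊t * 2 / ε⌋ ∈ Finset.Icc (-M) M := by
    intro t ht
    have h1 := abs_le.1 (abs_le_of_sq_le_sq ht hK0)
    rw [Finset.mem_Icc]
    have h2 : t * 2 / ε ≤ K * 2 / ε := by gcongr; exact h1.2
    have h3 : -(K * 2 / ε) ≤ t * 2 / ε := by
      rw [← neg_div, ← neg_mul]; gcongr; exact h1.1
    have h4 := Int.le_ceil (K * 2 / ε)
    constructor
    · rw [Int.le_floor, hM]; push_cast; linarith
    · refine Int.floor_le_iff.2 ?_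
      rw [hM]; push_cast; linarith
  have hmaps : ∀ v ∈ R, f v ∈ cells := by
    intro v hv
    have h1 := not_lt.1 (Finset.mem_filter.1 hv).2
    exact Finset.mem_product.2 ⟨hcell _ (by nlinarith [sq_nonneg (y v)]),
      hcell _ (by nlinarith [sq_nonneg (x v)])⟩
  have hfloor : ∀ s t : ℝ, ⌊s * 2 / ε⌋ = ⌊t * 2 / ε⌋ → (s - t) ^ 2 ≤ ε ^ 2 / 4 := by
    intro s t hst
    have h1 := Int.abs_sub_lt_one_of_floor_eq_floor hst
    have h2 : s * 2 / ε - t * 2 / ε = (s - t) * 2 / ε := by ring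
    rw [h2, abs_div, abs_of_pos hε, div_lt_one hε, abs_mul, abs_two] at h1
    rw [← sq_abs (s - t)]
    nlinarith [abs_nonneg (s - t)]
  have hfib : ∀ a ∈ cells, (R.filter fun v => f v = a).card ≤ ⌊c * m⌋₊ := by
    intro a _
    rcases (R.filter fun v => f v = a).eq_empty_or_nonempty with h | ⟨v, hv⟩
    · rw [h]; simp
    · obtain ⟨hvR, hva⟩ := Finset.mem_filter.1 hv
      have hvS := (Finset.mem_filter.1 (Finset.mem_filter.1 hvR).1).2
      refine Nat.le_floor (le_trans ?_ hvS.le)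
      rw [← Set.ncard_coe_finset]
      refine Nat.cast_le.2 (Set.ncard_le_ncard (fun u hu => ?_) (Set.toFinite _))
      have hu' := (Finset.mem_filter.1 (Finset.mem_coe.1 hu)).2
      have h1 := Prod.ext_iff.1 (hu'.trans hva.symm)
      have h2 := hfloor _ _ h1.1
      have h3 := hfloor _ _ h1.2
      rw [Set.mem_ofPred_eq]
      nlinarith
  have hRcard : (R.card : ℝ) ≤ η * m := by
    have h1 := Finset.card_le_mul_card_image_of_maps_to hmaps _ hfib
    have h2 : (R.card : ℝ) ≤ ⌊c * m⌋₊ * cells.card := by exact_mod_cast h1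
    have h3 : (⌊c * m⌋₊ : ℝ) ≤ c * m := Nat.floor_le (by positivity)
    calc (R.card : ℝ) ≤ c * m * cells.card := h2.trans (by gcongr)
      _ = η * m := by rw [hc]; field_simp
  have : (S.card : ℝ) = B.card + R.card := by exact_mod_cast hsplit.symm
  linarith

/-! ### Purity, size and edge counts of crops. -/

section Crop

variable {N : ℕ} {p q z : unitInterval}

lemma mem_crop_iff (b : NodeBasis N) {r : ℝ} (hr : 0 ≤ r) (u v : Node N) :
    u ∈ crop b r v ↔ (basisValue b 1 u - basisValue b 1 v) ^ 2 +
      (basisValue b 2 u - basisValue b 2 v) ^ 2 ≤ r ^ 2 := by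
  have h : u ∈ crop b r v ↔ ‖spectralEmbedding b u - spectralEmbedding b v‖ ≤ r := Iff.rfl
  rw [h, EuclideanSpace.norm_eq, Real.sqrt_le_left hr, Fin.sum_univ_two]
  simp [spectralEmbedding]

lemma sum_basisValue_sq_le (b : NodeBasis N) (j : ℕ) : ∑ v, basisValue b j v ^ 2 ≤ 1 := by
  by_cases hj : j < Fintype.card (Node N)
  · have h2 := EuclideanSpace.norm_sq_eq (b ⟨j, hj⟩)
    rw [b.orthonormal.norm_eq_one] at h2
    simp only [basisValue, dif_pos hj]
    refine le_of_eq ?_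
    simpa using h2.symm
  · simp only [basisValue, dif_neg hj]
    simp

/-- Rescaling by `√N` gives each coordinate total square at most `N`. The constant `c` depends on
neither `N` nor the basis, so no spectral information is required. -/
lemma exists_card_small_crop_le {ε η : ℝ} (hε : 0 < ε) (hη : 0 < η) :
    ∃ c : ℝ, 0 < c ∧ ∀ (N : ℕ) (b : NodeBasis N), 0 < N →
      ({v | ((crop b (ε / √(N : ℝ)) v).ncard : ℝ) < c * N} : Set (Node N)).ncard ≤
        2 * η * N := by
  obtain ⟨c, hc, h⟩ := exists_card_few_neighbours_le hε hη
  refine ⟨c, hc, fun N b hN => ?_⟩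
  have hN' : (0 : ℝ) < N := by exact_mod_cast hN
  have hsum : ∀ j, ∑ v, (√(N : ℝ) * basisValue b j v) ^ 2 ≤ N := by
    intro j
    simp only [mul_pow, Real.sq_sqrt hN'.le]
    rw [← Finset.mul_sum]
    exact mul_le_of_le_one_right hN'.le (sum_basisValue_sq_le b j)
  have h1 := h (Node N) N (fun v => √(N : ℝ) * basisValue b 1 v)
    (fun v => √(N : ℝ) * basisValue b 2 v) hN'.le (hsum 1) (hsum 2)
  have h2 : ∀ v, crop b (ε / √(N : ℝ)) v =
      {u | (√(N : ℝ) * basisValue b 1 u - √(N : ℝ) * basisValue b 1 v) ^ 2 +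
        (√(N : ℝ) * basisValue b 2 u - √(N : ℝ) * basisValue b 2 v) ^ 2 ≤ ε ^ 2} := by
    intro v
    ext u
    rw [mem_crop_iff b (by positivity), Set.mem_ofPred_eq, div_pow, Real.sq_sqrt hN'.le,
      le_div_iff₀ hN', ← mul_sub, ← mul_sub, mul_pow, mul_pow, Real.sq_sqrt hN'.le, ← mul_add,
      mul_comm]
  simpa only [h2] using h1

lemma self_mem_crop (b : NodeBasis N) {r : ℝ} (hr : 0 ≤ r) (v : Node N) : v ∈ crop b r v := by
  rw [mem_crop_iff b hr]
  simp
  positivity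

lemma label_eq_of_mem_crop (b : NodeBasis N) {r r' : ℝ} (hr : 0 ≤ r) (hrr : r < r')
    (hsep : ∀ u v, label u ≠ label v → r' ≤ |basisValue b 1 u - basisValue b 1 v|)
    {u v : Node N} (hu : u ∈ crop b r v) : label u = label v := by
  by_contra hne
  have h1 := hsep u v hne
  rw [mem_crop_iff b hr] at hu
  have h2 : |basisValue b 1 u - basisValue b 1 v| ≤ r := by
    refine abs_le_of_sq_le_sq ?_ hr
    nlinarith [sq_nonneg (basisValue b 2 u - basisValue b 2 v)]
  linarith

lemma isMajorityLabel_crop (b : NodeBasis N) {r : ℝ} (hr : 0 ≤ r) (v : Node N)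
    (h : ∀ u ∈ crop b r v, label u = label v) : IsMajorityLabel (crop b r v) (label v) := by
  have h1 : {u ∈ crop b r v | label u ≠ label v} = ∅ := by
    ext u
    simpa using h u
  rw [IsMajorityLabel, h1, Set.ncard_empty, Set.ncard_pos (Set.toFinite _)]
  exact ⟨v, self_mem_crop b hr v, rfl⟩

-- The quadratic form of the noise at the indicator of `C`, bounded through the operator norm; this
-- makes the estimate simultaneous in all `C`.
open Classical in
lemma IsTypical.abs_sum_adjacencyMatrix_sub_le {δ : ℝ} {G : LoopGraph N}
    (h : IsTypical p q z δ G) (hδ : 0 ≤ δ) (C : Set (Node N)) (i : Fin 2)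
    (hC : ∀ u ∈ C, label u = i) :
    |∑ a : C, ∑ c : C, adjacencyMatrix G a c - blockProb p q z i i * C.ncard ^ 2| ≤
      δ * N * C.ncard := by
  have hsum : ∀ f : Node N → ℝ, ∑ v, (if v ∈ C then 1 else 0) * f v = ∑ a : C, f a := by
    intro f
    simp only [ite_mul, one_mul, zero_mul]
    rw [← Finset.sum_filter]
    exact Finset.sum_subtype _ (by simp) f
  have hsum' : ∀ f : Node N → ℝ, ∑ v, f v * (if v ∈ C then 1 else 0) = ∑ a : C, f a := by
    intro f
    rw [← hsum]
    simp only [mul_comm]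
  have h1 := h.abs_sum_mul_noise_le hδ (fun v => if v ∈ C then 1 else 0)
  simp only [hsum', hsum] at h1
  have hcard : (Fintype.card C : ℝ) = C.ncard := by
    rw [Set.ncard_eq_toFinset_card', Set.toFinset_card]
  have h2 : ∑ u : Node N, (if u ∈ C then (1 : ℝ) else 0) ^ 2 = C.ncard := by
    rw [← hcard]
    simp [sq]
  rw [h2] at h1
  have h3 : ∑ a : C, ∑ c : C, adjacencyMatrix G a c =
      ∑ a : C, ∑ c : C, edgeNoise p q z G s(↑a, ↑c) + blockProb p q z i i * C.ncard ^ 2 := by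
    have h4 : ∀ a c : C, adjacencyMatrix G a c =
        edgeNoise p q z G s(↑a, ↑c) + blockProb p q z i i := by
      intro a c
      rw [adjacencyMatrix_eq (p := p) (q := q) (z := z), hC a a.2, hC c c.2, add_comm]
    simp only [h4, Finset.sum_add_distrib, Finset.sum_const, Finset.card_univ, nsmul_eq_mul, hcard]
    ring
  rw [h3, add_sub_cancel_right]
  exact h1

lemma InducedIso.symm {G : LoopGraph N} {C C' : Set (Node N)} (h : InducedIso G C C') :
    InducedIso G C' C := h.map RelIso.symm

open Classical in
lemma InducedIso.sum_adjacencyMatrix_eq {G : LoopGraph N} {C C' : Set (Node N)}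
    (h : InducedIso G C C') :
    ∑ a : C, ∑ c : C, adjacencyMatrix G a c = ∑ a : C', ∑ c : C', adjacencyMatrix G a c := by
  obtain ⟨e⟩ := h
  rw [← Equiv.sum_comp e.toEquiv]
  refine Finset.sum_congr rfl fun a _ => ?_
  rw [← Equiv.sum_comp e.toEquiv]
  refine Finset.sum_congr rfl fun c _ => ?_
  have h1 := e.map_rel_iff (a := a) (b := c)
  simp only [Adjacent] at h1
  simp only [adjacencyMatrix, Matrix.of_apply]
  exact if_congr h1.symm rfl rfl

lemma InducedIso.ncard_eq {G : LoopGraph N} {C C' : Set (Node N)} (h : InducedIso G C C') :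
    C.ncard = C'.ncard := by
  obtain ⟨e⟩ := h
  exact Nat.card_congr e.toEquiv

/-- Isomorphic subgraphs induced on subsets of different blocks are small. -/
lemma IsTypical.ncard_le_of_inducedIso {δ : ℝ} {G : LoopGraph N} (h : IsTypical p q z δ G)
    (hδ : 0 ≤ δ) (C C' : Set (Node N)) (hC : ∀ u ∈ C, label u = 0) (hC' : ∀ u ∈ C', label u = 1)
    (hiso : InducedIso G C C') : (p - q : ℝ) * C.ncard ≤ 2 * δ * N := by
  classical
  have h0 := h.abs_sum_adjacencyMatrix_sub_le hδ C 0 hC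
  have h1 := h.abs_sum_adjacencyMatrix_sub_le hδ C' 1 hC'
  rw [blockProb_zero_zero] at h0
  rw [blockProb_one_one, ← hiso.sum_adjacencyMatrix_eq, ← hiso.ncard_eq] at h1
  rcases Nat.eq_zero_or_pos C.ncard with hm | hm
  · rw [hm]; simp; positivity
  · have hm' : (0 : ℝ) < C.ncard := by exact_mod_cast hm
    refine le_of_mul_le_mul_right ?_ hm'
    nlinarith [(abs_le.1 h0).1, (abs_le.1 h1).2]

lemma IsTypical.ncard_le_of_inducedIso_of_label_ne {δ : ℝ} {G : LoopGraph N}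
    (h : IsTypical p q z δ G) (hδ : 0 ≤ δ) (C C' : Set (Node N)) {i j : Fin 2} (hij : i ≠ j)
    (hC : ∀ u ∈ C, label u = i) (hC' : ∀ u ∈ C', label u = j)
    (hiso : InducedIso G C C') : (p - q : ℝ) * C.ncard ≤ 2 * δ * N := by
  rcases (by omega : (i = 0 ∧ j = 1) ∨ (i = 1 ∧ j = 0)) with ⟨rfl, rfl⟩ | ⟨rfl, rfl⟩
  · exact h.ncard_le_of_inducedIso hδ C C' hC hC' hiso
  · rw [hiso.ncard_eq]
    exact h.ncard_le_of_inducedIso hδ C' C hC' hC hiso.symm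

end Crop

/-! ### Passage to probabilities and limits. -/

section Limit

lemma isProbabilityMeasure_uniformNode {N : ℕ} (hN : 0 < N) :
    IsProbabilityMeasure (uniformNode N) := by
  have : NeZero N := ⟨hN.ne'⟩
  exact isProbabilityMeasure_uniformOn Set.finite_univ Set.univ_nonempty

instance isFiniteMeasure_uniformNode (N : ℕ) : IsFiniteMeasure (uniformNode N) := by
  unfold uniformNode uniformOn; infer_instance

lemma uniformNode_real_apply {N : ℕ} (s : Set (Node N)) :
    (uniformNode N).real s = s.ncard / (2 * N) := by
  rw [measureReal_def, uniformNode, uniformOn_univ,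
    Measure.count_apply (Set.toFinite s).measurableSet, ENNReal.toReal_div, Set.ncard_def]
  congr 1
  · rw [(Set.toFinite s).encard_eq_coe_toFinset_card]
    simp
  · simp

lemma uniformNode_real_label {N : ℕ} (hN : 0 < N) (i : Fin 2) :
    (uniformNode N).real {v | label v = i} = 1 / 2 := by
  have hN' : (0 : ℝ) < N := by exact_mod_cast hN
  have h : ({v : Node N | label v = i}).ncard = N := by
    have : ({v : Node N | label v = i}) = Set.range fun k : Fin N => ((i, k) : Node N) := by
      ext ⟨j, k⟩
      simp [label, eq_comm]
    rw [this, Set.ncard_range_of_injective (Prod.mk_right_injective i)]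
    simp
  rw [uniformNode_real_apply, h]
  field_simp

lemma prod_real_le_of_forall {α β : Type*} [MeasurableSpace α] [MeasurableSpace β]
    [Finite α] [Finite β] [MeasurableSingletonClass α] [MeasurableSingletonClass β]
    (μ : Measure α) [IsProbabilityMeasure μ] (ν : Measure β) [IsFiniteMeasure ν]
    (s : Set (α × β)) {r : ℝ} (hr : 0 ≤ r) (h : ∀ a, ν.real (Prod.mk a ⁻¹' s) ≤ r) :
    (μ.prod ν).real s ≤ r := by
  rw [measureReal_def]
  refine ENNReal.toReal_le_of_le_ofReal hr ?_
  rw [Measure.prod_apply (Set.toFinite s).measurableSet]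
  calc ∫⁻ a, ν (Prod.mk a ⁻¹' s) ∂μ ≤ ∫⁻ _, ENNReal.ofReal r ∂μ :=
        lintegral_mono fun a => (ENNReal.le_ofReal_iff_toReal_le (measure_ne_top _ _) hr).2 (h a)
    _ = ENNReal.ofReal r := by simp

/-- Positive `N` is required because for `N = 0` there is no node and the uniform measure is zero.
-/
lemma tendsto_measure_one_of_compl {Ω : ℕ → Type*} [∀ N, MeasurableSpace (Ω N)]
    [∀ N, Finite (Ω N)] [∀ N, MeasurableSingletonClass (Ω N)] (P : ∀ N, Measure (Ω N))
    (hP : ∀ N, 0 < N → IsProbabilityMeasure (P N)) (s : ∀ N, Set (Ω N))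
    (h : Tendsto (fun N => (P N).real (s N)ᶜ) atTop (𝓝 0)) :
    Tendsto (fun N => P N (s N)) atTop (𝓝 1) := by
  have h1 : Tendsto (fun N => 1 - ENNReal.ofReal ((P N).real (s N)ᶜ)) atTop (𝓝 1) := by
    have := ENNReal.Tendsto.sub (tendsto_const_nhds (x := (1 : ENNReal)))
      (ENNReal.tendsto_ofReal h) (Or.inl ENNReal.one_ne_top)
    simpa using this
  refine h1.congr' ((eventually_gt_atTop 0).mono fun N hN => ?_)
  have := hP N hN
  dsimp only
  rw [ofReal_measureReal, ← prob_compl_eq_one_sub (Set.toFinite _).measurableSet, compl_compl]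

variable (p q z : unitInterval)

lemma tendsto_measureReal_not_isTypical {δ : ℝ} (hδ : 0 < δ) :
    Tendsto (fun N : ℕ => (sbm N p q z).real {G | ¬ IsTypical p q z δ G}) atTop (𝓝 0) := by
  simpa [measureReal_def, Function.comp_def] using
    (ENNReal.tendsto_toReal ENNReal.zero_ne_top).comp (tendsto_measure_not_isTypical p q z hδ)

lemma prod_real_not_isTypical_le {N : ℕ} (hN : 0 < N) (δ : ℝ) :
    ((sbm N p q z).prod (uniformNode N)).real {ω | ¬ IsTypical p q z δ ω.1} ≤
      (sbm N p q z).real {G | ¬ IsTypical p q z δ G} := by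
  have := isProbabilityMeasure_uniformNode hN
  have h : {ω : LoopGraph N × Node N | ¬ IsTypical p q z δ ω.1} =
      {G | ¬ IsTypical p q z δ G} ×ˢ Set.univ := by ext; simp
  rw [h, measureReal_prod_prod]
  simp

variable {p q z}

/-- The event that some node of the other label has a crop isomorphic to the crop of the given
node is asymptotically negligible, if crops contain a single label in typical graphs. -/
lemma tendsto_measureReal_exists_inducedIso (hqp : q < p) {ε δ₀ : ℝ} (hε : 0 < ε) (hδ₀ : 0 < δ₀)
    (b : (N : ℕ) → LoopGraph N → NodeBasis N)
    (hlabel : ∀ (N : ℕ) (G : LoopGraph N), 0 < N → IsTypical p q z δ₀ G →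
      ∀ v, ∀ u ∈ crop (b N G) (ε / √(N : ℝ)) v, label u = label v) :
    Tendsto (fun N : ℕ => ((sbm N p q z).prod (uniformNode N)).real
      {ω | ∃ v' : Node N, label v' ≠ label ω.2 ∧
        InducedIso ω.1 (crop (b N ω.1) (ε / √(N : ℝ)) ω.2)
          (crop (b N ω.1) (ε / √(N : ℝ)) v')}) atTop (𝓝 0) := by
  have hqp' : (0 : ℝ) < p - q := sub_pos.2 hqp
  refine Metric.tendsto_nhds.2 fun η hη => ?_
  obtain ⟨c, hc, hsmall⟩ := exists_card_small_crop_le hε (show 0 < η / 4 by positivity)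
  -- A second typicality level: `δ₀` goes with the fixed radius, whereas `δ₁` is chosen after `c`,
  -- which depends on `ε` and on the tolerance `η`. It makes `2δ₁N` half of `(p - q)cN`, excluding
  -- isomorphic crops of size at least `cN`.
  set δ₁ : ℝ := c * (p - q) / 4 with hδ₁
  have hδ₁0 : 0 < δ₁ := by positivity
  have ht₀ := (tendsto_measureReal_not_isTypical p q z hδ₀).eventually (gt_mem_nhds
    (show 0 < η / 4 by positivity))
  have ht₁ := (tendsto_measureReal_not_isTypical p q z hδ₁0).eventually (gt_mem_nhds
    (show 0 < η / 4 by positivity))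
  filter_upwards [ht₀, ht₁, eventually_gt_atTop 0] with N h₀ h₁ hN
  have hN' : (0 : ℝ) < N := by exact_mod_cast hN
  rw [Real.dist_eq, sub_zero, abs_of_nonneg measureReal_nonneg]
  set small : Set (LoopGraph N × Node N) :=
    {ω | ((crop (b N ω.1) (ε / √(N : ℝ)) ω.2).ncard : ℝ) < c * N} with hsm
  have hsub : {ω : LoopGraph N × Node N | ∃ v' : Node N, label v' ≠ label ω.2 ∧
        InducedIso ω.1 (crop (b N ω.1) (ε / √(N : ℝ)) ω.2)
          (crop (b N ω.1) (ε / √(N : ℝ)) v')} ⊆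
      ({ω | ¬ IsTypical p q z δ₀ ω.1} ∪ {ω | ¬ IsTypical p q z δ₁ ω.1}) ∪ small := by
    rintro ω ⟨v', hv', hiso⟩
    by_contra hcon
    simp only [Set.mem_union, Set.mem_ofPred_eq, not_or, not_not, hsm, not_lt] at hcon
    obtain ⟨⟨hty₀, hty₁⟩, hlarge⟩ := hcon
    have h2 := hty₁.ncard_le_of_inducedIso_of_label_ne hδ₁0.le _ _ hv'.symm
      (hlabel N ω.1 hN hty₀ ω.2) (hlabel N ω.1 hN hty₀ v') hiso
    have h3 := mul_le_mul_of_nonneg_left hlarge hqp'.le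
    have h4 : 0 < c * (p - q) * N := by positivity
    rw [hδ₁] at h2
    linarith
  have hsmall_le : ((sbm N p q z).prod (uniformNode N)).real small ≤ η / 4 := by
    refine prod_real_le_of_forall _ _ _ (by positivity) fun G => ?_
    rw [uniformNode_real_apply, div_le_iff₀ (by positivity)]
    have := hsmall N (b N G) hN
    refine le_trans this (le_of_eq ?_)
    ring
  calc _ ≤ _ := measureReal_mono hsub
    _ ≤ _ := measureReal_union_le _ _
    _ ≤ _ := add_le_add (measureReal_union_le _ _) hsmall_le
    _ < η := by
      have h5 := prod_real_not_isTypical_le p q z hN δ₀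
      have h6 := prod_real_not_isTypical_le p q z hN δ₁
      linarith

lemma le_measureReal_label_ne {N : ℕ} (hN : 0 < N) :
    1 / 4 ≤ ((sbm N p q z).prod ((uniformNode N).prod (uniformNode N))).real
      {ω | label ω.2.1 ≠ label ω.2.2} := by
  have h : (Set.univ ×ˢ ({v : Node N | label v = 0} ×ˢ {v : Node N | label v = 1}) :
      Set (LoopGraph N × Node N × Node N)) ⊆ {ω | label ω.2.1 ≠ label ω.2.2} := by
    rintro ⟨G, v, v'⟩ ⟨-, hv, hv'⟩
    have h1 : label v = 0 := hv
    have h2 : label v' = 1 := hv'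
    simp [h1, h2]
  refine le_trans (le_of_eq ?_) (measureReal_mono h)
  rw [measureReal_prod_prod, measureReal_prod_prod, uniformNode_real_label hN,
    uniformNode_real_label hN, probReal_univ]
  norm_num

end Limit

end

/-! ### The main theorem. -/

theorem mainTheorem2 (p q z : unitInterval) (hz : 0 < z) (hzq : z < q) (hqp : q < p) :
    ∃ ε : ℝ, 0 < ε ∧
      ∀ b : (N : ℕ) → LoopGraph N → NodeBasis N,
        (∀ N G, IsSortedEigenbasis (laplacian G) (b N G)) →
        Tendsto (fun N : ℕ => ((sbm N p q z).prod (uniformNode N))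
            {ω | IsMajorityLabel (crop (b N ω.1) (ε / √(N : ℝ)) ω.2) (label ω.2)})
          atTop (𝓝 1) ∧
        Tendsto (fun N : ℕ =>
            (cond ((sbm N p q z).prod ((uniformNode N).prod (uniformNode N)))
              {ω | label ω.2.1 ≠ label ω.2.2})
            {ω | ¬ InducedIso ω.1 (crop (b N ω.1) (ε / √(N : ℝ)) ω.2.1)
              (crop (b N ω.1) (ε / √(N : ℝ)) ω.2.2)})
          atTop (𝓝 1) ∧
        Tendsto (fun N : ℕ => ((sbm N p q z).prod (uniformNode N))
            {ω | ∀ v' : Node N, label v' ≠ label ω.2 →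
              ¬ InducedIso ω.1 (crop (b N ω.1) (ε / √(N : ℝ)) ω.2)
                (crop (b N ω.1) (ε / √(N : ℝ)) v')})
          atTop (𝓝 1) := by
  have hz' : (0 : ℝ) < z := hz
  have hzq' : (0 : ℝ) < q - z := sub_pos.2 hzq
  have hqp' : (0 : ℝ) < p - q := sub_pos.2 hqp
  set γ : ℝ := z ^ 4 * (p - q)
  have hγ0 : 0 < γ := by positivity
  set C : ℝ := 10 / (((q - z : ℝ) / 6) ^ 2 * z ^ 4)
  have hC0 : 0 < C := by positivity
  obtain ⟨δ, hδ, hδz, hδq, hδγ⟩ : ∃ δ : ℝ, 0 < δ ∧ 2 * δ ≤ z ∧ 2 * δ ≤ q - z ∧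
      C * δ ≤ γ / 3360 := by
    refine ⟨min (min (z / 2) ((q - z) / 2)) (γ / 3360 / C), by positivity, ?_, ?_, ?_⟩
    · have := (min_le_left (min ((z : ℝ) / 2) ((q - z) / 2)) (γ / 3360 / C)).trans
        (min_le_left _ _)
      linarith
    · have := (min_le_left (min ((z : ℝ) / 2) ((q - z) / 2)) (γ / 3360 / C)).trans
        (min_le_right _ _)
      linarith
    · have := min_le_right (min ((z : ℝ) / 2) ((q - z) / 2)) (γ / 3360 / C)
      rw [le_div_iff₀ hC0] at this
      linarith
  -- Half of the separation `γ/560`, so that crops are strictly smaller than the gap between the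
  -- blocks.
  refine ⟨γ / 1120, by positivity, fun b hb => ?_⟩
  have hlabel : ∀ (N : ℕ) (G : LoopGraph N), 0 < N → IsTypical p q z δ G →
      ∀ v, ∀ u ∈ crop (b N G) (γ / 1120 / √(N : ℝ)) v, label u = label v := by
    intro N G hN hG v u hu
    have hN' : (0 : ℝ) < √(N : ℝ) := Real.sqrt_pos.2 (by exact_mod_cast hN)
    refine label_eq_of_mem_crop (b N G) (r' := γ / 560 / √(N : ℝ)) (by positivity) ?_
      (fun u v huv => hG.second_eigenvector_separated hz hzq hqp hδ.le hδz hδq hδγ hN (b N G)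
        (hb N G) u v huv) hu
    exact div_lt_div_of_pos_right (by linarith) hN'
  have hbad := tendsto_measureReal_exists_inducedIso hqp (show 0 < γ / 1120 by positivity) hδ b
    hlabel
  refine ⟨?_, ?_, ?_⟩
  · refine tendsto_measure_one_of_compl _ (fun N hN => ?_) _ ?_
    · have := isProbabilityMeasure_uniformNode hN
      infer_instance
    · refine squeeze_zero' (Eventually.of_forall fun _ => measureReal_nonneg)
        ((eventually_gt_atTop 0).mono fun N hN => ?_) (tendsto_measureReal_not_isTypical p q z hδ)
      refine (measureReal_mono ?_).trans (prod_real_not_isTypical_le p q z hN δ)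
      intro ω hω hty
      exact hω (isMajorityLabel_crop _ (by positivity) _ (hlabel N ω.1 hN hty ω.2))
  · refine tendsto_measure_one_of_compl _ (fun N hN => ?_) _ ?_
    · refine cond_isProbabilityMeasure fun h => ?_
      have h1 := le_measureReal_label_ne (p := p) (q := q) (z := z) hN
      rw [measureReal_def, h] at h1
      norm_num at h1
    -- Conditioning costs a factor of at most 4. The bad pair `(v, v')` is absorbed into the event
    -- that some node of the other label is bad for `v`, which depends only on the graph and `v`.
    · have hbad4 := hbad.const_mul 4
      rw [mul_zero] at hbad4
      refine squeeze_zero' (Eventually.of_forall fun _ => measureReal_nonneg)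
        ((eventually_gt_atTop 0).mono fun N hN => ?_) hbad4
      have := isProbabilityMeasure_uniformNode hN
      have h1 := le_measureReal_label_ne (p := p) (q := q) (z := z) hN
      set B : Set (LoopGraph N × Node N) := {ω | ∃ v' : Node N, label v' ≠ label ω.2 ∧
        InducedIso ω.1 (crop (b N ω.1) (γ / 1120 / √(N : ℝ)) ω.2)
          (crop (b N ω.1) (γ / 1120 / √(N : ℝ)) v')}
      have hmp : MeasurePreserving (Prod.map id Prod.fst)
          ((sbm N p q z).prod ((uniformNode N).prod (uniformNode N)))
          ((sbm N p q z).prod (uniformNode N)) :=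
        (MeasurePreserving.id _).prod measurePreserving_fst
      have h2 := hmp.measureReal_preimage (s := B) (Set.toFinite B).measurableSet.nullMeasurableSet
      rw [measureReal_def, cond_apply (Set.toFinite _).measurableSet, ENNReal.toReal_mul,
        ENNReal.toReal_inv, ← measureReal_def, ← measureReal_def]
      refine mul_le_mul ?_ (le_of_le_of_eq (measureReal_mono ?_ (measure_ne_top _ _)) h2)
        measureReal_nonneg (by norm_num)
      · exact inv_le_of_inv_le₀ (by norm_num) (by linarith)
      · rintro ω ⟨hne, hiso⟩
        exact ⟨ω.2.2, Ne.symm hne, not_not.1 hiso⟩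
  · refine tendsto_measure_one_of_compl _ (fun N hN => ?_) _ ?_
    · have := isProbabilityMeasure_uniformNode hN
      infer_instance
    · refine hbad.congr fun N => congrArg _ ?_
      ext ω
      simp only [Set.mem_compl_iff, Set.mem_ofPred_eq, not_forall, not_not, exists_prop]
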